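/- Let $k$ be a field with $\mathrm{char}(k)\neq 2$ and let $A=A_+\oplus A_-$ be a super-affine Hopf algebra over $k$: a finitely generated super-commutative $k$-superalgebra with a coassociative comultiplication $m^*:A\to A\otimes^\varepsilon A$, a counit $e^*:A\to k$ and an antipode $i^*:A\to A$ which are morphisms of superalgebras; here $\otimes^\varepsilon$ is the tensor product with the sign rule $(a\otimes b)(a'\otimes b')=(-1)^{|b||a'|}aa'\otimes bb'$. Let $J$ be the super radical of $A$, i.e. the ideal generated by $A_-$, let $\pi:A\to B=A/J$ be the quotient map and $G=\mathrm{Spec}(B)$. Then $A$ is a $B$-comodule via $\Delta=(\mathrm{id}\otimes\pi)\circ m^*$, with quotient comodule $J/J^2$ of its subcomodule $J$, and for a $B$-comodule $(V,\Delta_V)$ we put $V^G=\{v\in V:\Delta_V(v)=v\otimes 1\}$. Let $\mathfrak g_-$ be the space of odd left-invariant $k$-superderivations of $A$ (odd $k$-linear $D:A\to A$ with $D(ab)=D(a)b+(-1)^{|a|}aD(b)$ for homogeneous $a$ and $m^*\circ D=(\mathrm{id}\otimes^\varepsilon D)\circ m^*$); it is finite dimensional, and we put $s=\dim_k\mathfrak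 g_-$. Assume $\mathrm{char}(k)=0$ or $\mathrm{char}(k)>s$. There exist odd elements $\theta_1,\dots,\theta_s\in A^G$ whose classes modulo $J^2$ form a $k$-basis of $(J/J^2)^G$, together with odd right-invariant superderivations $D'_1,\dots,D'_s$ of $A$ (that is, $m^*\circ D'_i=(D'_i\otimes\mathrm{id})\circ m^*$) such that $e^*(D'_i(\theta_j))=\delta_{ij}$. For every such choice put $D(x)=\sum_{i=1}^s\theta_i D'_i(x)$ and $\tilde B=\ker(D:A\to A)$. Then $A^G$ and $\tilde B$ are graded $k$-subalgebras of $A$, and: 1. $\tilde B\subset A_+$, and $\pi$ restricts to an (even) isomorphism of $k$-algebras $\tilde B\cong B$; 2. multiplication is an isomorphism of $k$-superalgebras $A^G\otimes^\varepsilon\tilde B\cong A$; 3. the superpolynomial ring $k[\theta_1,\dots,\theta_s]$ in $s$ odd variables (the exterior algebra on $k^s$) maps isomorphically onto $A^G$, its $i$-th variable going to the element $\theta_i\in A^G$; hence, again by multiplication, $k[\theta_1,\dots,\theta_s]\otimes^\varepsilon\tilde B\cong A$ as $k$-superalgebras. -/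

import Mathlib

open scoped TensorProduct

noncomputable section

namespace SuperHopf

variable {k : Type*} [Field k]

/-- The total `ℤ/2`-grading on the tensor product of two `ℤ/2`-graded algebras: the degree `i`
part is spanned by the tensors `a ⊗ b` with `a`, `b` homogeneous and `|a| + |b| = i`. -/
def tensorGrading {A B : Type*} [Ring A] [Algebra k A] [Ring B] [Algebra k B]
    (𝒜 : ZMod 2 → Submodule k A) (ℬ : ZMod 2 → Submodule k B)
    [GradedAlgebra 𝒜] [GradedAlgebra ℬ] (i : ZMod 2) : Submodule k (𝒜 ᵍ⊗[k] ℬ) :=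
  Submodule.span k
    {t | ∃ p q : ZMod 2, p + q = i ∧ ∃ a ∈ 𝒜 p, ∃ b ∈ ℬ q, t = GradedTensorProduct.tmul k a b}

/-- An isomorphism of superalgebras: an isomorphism of algebras matching the gradings. -/
def IsEvenEquiv {A B : Type*} [Ring A] [Algebra k A] [Ring B] [Algebra k B]
    (𝒜 : ZMod 2 → Submodule k A) (ℬ : ZMod 2 → Submodule k B) (e : A ≃ₐ[k] B) : Prop :=
  ∀ i, (𝒜 i).map e.toAlgHom.toLinearMap = ℬ i

/-- The grading `i ↦ S ∩ 𝒜 i` on a subalgebra `S`. -/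
def inducedGrading {A : Type*} [Ring A] [Algebra k A]
    (𝒜 : ZMod 2 → Submodule k A) (S : Subalgebra k A) (i : ZMod 2) : Submodule k S :=
  (𝒜 i).comap S.val.toLinearMap

section

variable {A : Type*} [Ring A] [Algebra k A]

/-- Super-commutativity `x y = (-1)^{|x||y|} y x`; the sign is nontrivial only for two odd
elements. -/
class IsSuperCommutative (𝒜 : ZMod 2 → Submodule k A) : Prop where
  mul_comm_of_even : ∀ i, ∀ a ∈ 𝒜 0, ∀ b ∈ 𝒜 i, a * b = b * a
  mul_comm_of_odd : ∀ a ∈ 𝒜 1, ∀ b ∈ 𝒜 1, a * b = -(b * a)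

variable (𝒜 : ZMod 2 → Submodule k A)

/-- A super-affine Hopf algebra over `k`: a finitely generated super-commutative `k`-algebra with
a coassociative counital coalgebra structure (the class `Coalgebra k A`) whose comultiplication
`A → A ⊗^ε A`, counit `A → k` and antipode `A → A` are morphisms of superalgebras. -/
class IsSuperAffineHopfAlgebra [GradedAlgebra 𝒜] [Coalgebra k A] : Prop
    extends IsSuperCommutative 𝒜 where
  finiteType : Algebra.FiniteType k A
  comul_one : GradedTensorProduct.of k 𝒜 𝒜 (Coalgebra.comul (1 : A)) = 1
  comul_mul : ∀ a b : A,
    GradedTensorProduct.of k 𝒜 𝒜 (Coalgebra.comul (a * b)) =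
      GradedTensorProduct.of k 𝒜 𝒜 (Coalgebra.comul a) *
        GradedTensorProduct.of k 𝒜 𝒜 (Coalgebra.comul b)
  comul_mem : ∀ i, ∀ a ∈ 𝒜 i,
    GradedTensorProduct.of k 𝒜 𝒜 (Coalgebra.comul a) ∈ tensorGrading 𝒜 𝒜 i
  counit_one : Coalgebra.counit (R := k) (1 : A) = 1
  counit_mul : ∀ a b : A, Coalgebra.counit (R := k) (a * b) =
    Coalgebra.counit (R := k) a * Coalgebra.counit (R := k) b
  counit_odd : ∀ a ∈ 𝒜 1, Coalgebra.counit (R := k) a = 0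
  exists_antipode : ∃ S : A →ₐ[k] A, (∀ i, ∀ a ∈ 𝒜 i, S a ∈ 𝒜 i) ∧
    (∀ a : A, LinearMap.mul' k A (S.toLinearMap.rTensor A (Coalgebra.comul a)) =
      algebraMap k A (Coalgebra.counit a)) ∧
    (∀ a : A, LinearMap.mul' k A (S.toLinearMap.lTensor A (Coalgebra.comul a)) =
      algebraMap k A (Coalgebra.counit a))

/-- The super radical `J`: the ideal generated by the odd part `𝒜 1`. By super-commutativity the
left ideal generated by `𝒜 1` is two-sided, see the instance below. -/
def superRadical : Ideal A := Ideal.span (𝒜 1 : Set A)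

instance superRadical_isTwoSided [GradedAlgebra 𝒜] [IsSuperCommutative 𝒜] :
    (superRadical 𝒜).IsTwoSided := by
  classical
  refine ⟨fun {a} b ha => ?_⟩
  have hb : b = (DirectSum.decompose 𝒜 b 0 : A) + (DirectSum.decompose 𝒜 b 1 : A) := by
    conv_lhs => rw [← DirectSum.sum_support_decompose 𝒜 b]
    rw [Finset.sum_subset (Finset.subset_univ _)]
    · exact Fin.sum_univ_two _
    · intro i _ hi
      simpa using hi
  unfold superRadical at ha ⊢
  induction ha using Submodule.span_induction with
  | mem x hx =>
    rw [hb, mul_add,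
      ← IsSuperCommutative.mul_comm_of_even 1 _ (DirectSum.decompose 𝒜 b 0).2 x hx,
      IsSuperCommutative.mul_comm_of_odd x hx _ (DirectSum.decompose 𝒜 b 1).2]
    exact add_mem (Ideal.mul_mem_left _ _ (Ideal.subset_span hx))
      (neg_mem (Ideal.mul_mem_left _ _ (Ideal.subset_span hx)))
  | zero => simp
  | add x y _ _ h1 h2 => rw [add_mul]; exact add_mem h1 h2
  | smul c x _ h => rw [smul_eq_mul, mul_assoc]; exact Ideal.mul_mem_left _ _ h

variable [GradedAlgebra 𝒜]

/-- The parity involution `a ↦ (-1)^{|a|} a`. -/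
def parity : A →ₗ[k] A := GradedAlgebra.proj 𝒜 0 - GradedAlgebra.proj 𝒜 1

/-- Odd `k`-linear superderivations of `A`: odd maps `D` with
`D (a b) = D a · b + (-1)^{|a|} a · D b`. -/
def oddSuperDer : Submodule k (A →ₗ[k] A) where
  carrier := {D | (∀ i, ∀ a ∈ 𝒜 i, D a ∈ 𝒜 (i + 1)) ∧
    ∀ a b, D (a * b) = D a * b + parity 𝒜 a * D b}
  add_mem' := by
    rintro D E ⟨hD, hD'⟩ ⟨hE, hE'⟩
    refine ⟨fun i a ha => add_mem (hD i a ha) (hE i a ha), fun a b => ?_⟩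
    simp only [LinearMap.add_apply, hD', hE', add_mul, mul_add]
    abel
  zero_mem' := ⟨fun i a _ => by simp, fun a b => by simp⟩
  smul_mem' := by
    rintro c D ⟨hD, hD'⟩
    refine ⟨fun i a ha => Submodule.smul_mem _ c (hD i a ha), fun a b => ?_⟩
    simp only [LinearMap.smul_apply, hD', smul_add, smul_mul_assoc, mul_smul_comm]

variable [Coalgebra k A]

/-- `𝔤_-`, the odd part of `Lie(A)`: odd superderivations `D` that are left-invariant, i.e.
`Δ ∘ D = (id ⊗^ε D) ∘ Δ`. By the sign rule `(id ⊗^ε D)(a ⊗ b) = (-1)^{|a|} a ⊗ D b` as `D` is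
odd. -/
def gMinus : Submodule k (A →ₗ[k] A) where
  carrier := {D | D ∈ oddSuperDer 𝒜 ∧
    Coalgebra.comul ∘ₗ D = TensorProduct.map (parity 𝒜) D ∘ₗ Coalgebra.comul}
  add_mem' := by
    rintro D E ⟨hD, hD'⟩ ⟨hE, hE'⟩
    refine ⟨add_mem hD hE, ?_⟩
    rw [LinearMap.comp_add, hD', hE', TensorProduct.map_add_right, LinearMap.add_comp]
  zero_mem' := ⟨zero_mem _, by simp [TensorProduct.map_zero_right]⟩
  smul_mem' := by
    rintro c D ⟨hD, hD'⟩
    refine ⟨Submodule.smul_mem _ c hD, ?_⟩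
    rw [LinearMap.comp_smul, hD', TensorProduct.map_smul_right, LinearMap.smul_comp]

/-- Odd right-invariant superderivations: `Δ ∘ D = (D ⊗ id) ∘ Δ`. -/
def IsOddRightInvariant (D : A →ₗ[k] A) : Prop :=
  D ∈ oddSuperDer 𝒜 ∧ Coalgebra.comul ∘ₗ D = D.rTensor A ∘ₗ Coalgebra.comul

section quotient

variable [IsSuperCommutative 𝒜]

/-- `B = A / J`. -/
abbrev Bquot : Type _ := A ⧸ superRadical 𝒜

/-- The quotient map `π : A → B`. -/
def piMap : A →ₐ[k] Bquot 𝒜 := Ideal.Quotient.mkₐ k (superRadical 𝒜)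

/-- The `B`-comodule structure `(id ⊗ π) ∘ Δ : A → A ⊗ B` of `A`. -/
def coaction : A →ₗ[k] A ⊗[k] Bquot 𝒜 :=
  (piMap 𝒜).toLinearMap.lTensor A ∘ₗ Coalgebra.comul

/-- The invariants `A^G`, `G = Spec B`: all `v` with coaction `v ⊗ 1`. -/
def invariants : Submodule k A :=
  LinearMap.eqLocus (coaction 𝒜) ((TensorProduct.mk k A (Bquot 𝒜)).flip 1)

/-- The quotient map `A → A / J²` as a `k`-linear map. -/
def modSq : A →ₗ[k] A ⧸ (superRadical 𝒜 * superRadical 𝒜) :=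
  (Submodule.mkQ (superRadical 𝒜 * superRadical 𝒜)).restrictScalars k

/-- The invariants `(J/J²)^G` of the quotient comodule `J/J²`, as a subspace of `A/J²`: the classes
of all `x ∈ J` whose coaction, read in `(A/J²) ⊗ B`, is `[x] ⊗ 1`. -/
def invariantsJModSq : Submodule k (A ⧸ (superRadical 𝒜 * superRadical 𝒜)) :=
  ((superRadical 𝒜).restrictScalars k ⊓
    LinearMap.eqLocus ((modSq 𝒜).rTensor (Bquot 𝒜) ∘ₗ coaction 𝒜)
      ((TensorProduct.mk k (A ⧸ (superRadical 𝒜 * superRadical 𝒜)) (Bquot 𝒜)).flip 1 ∘ₗ modSq 𝒜)).map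
    (modSq 𝒜)

/-- Admissible choices: `θ₁, …, θₛ ∈ (J_-)^G` represent a `k`-basis of `(J/J²)^G`, and
`D'₁, …, D'ₛ` are odd right-invariant superderivations with `e(D'ᵢ θⱼ) = δᵢⱼ`, `e` the counit. -/
structure IsAdapted {s : ℕ} (θ : Fin s → A) (D' : Fin s → A →ₗ[k] A) : Prop where
  odd : ∀ i, θ i ∈ 𝒜 1
  invariant : ∀ i, θ i ∈ invariants 𝒜
  linearIndependent : LinearIndependent k (fun i => modSq 𝒜 (θ i))
  span_eq : Submodule.span k (Set.range fun i => modSq 𝒜 (θ i)) = invariantsJModSq 𝒜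
  rightInvariant : ∀ i, IsOddRightInvariant 𝒜 (D' i)
  dual : ∀ i j, Coalgebra.counit (R := k) (D' i (θ j)) = if i = j then 1 else 0

end quotient

end

/-- The Euler operator `D = ∑ θᵢ D'ᵢ`. -/
def eulerDerivation {A : Type*} [Ring A] [Algebra k A] {s : ℕ}
    (θ : Fin s → A) (D' : Fin s → A →ₗ[k] A) : A →ₗ[k] A :=
  ∑ i, LinearMap.mulLeft k (θ i) ∘ₗ D' i

/-- The superpolynomial ring `k[θ₁, …, θₛ]` in `s` odd variables, i.e. the exterior algebra. -/
abbrev SuperPoly (k : Type*) [Field k] (s : ℕ) : Type _ := ExteriorAlgebra k (Fin s → k)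

/-- The `ℤ/2`-grading of the superpolynomial ring, in which the variables are odd. -/
abbrev superPolyGrading (k : Type*) [Field k] (s : ℕ) : ZMod 2 → Submodule k (SuperPoly k s) :=
  CliffordAlgebra.evenOdd (0 : QuadraticForm k (Fin s → k))

/-- The variable `θᵢ` of the superpolynomial ring. -/
def superPolyVar (k : Type*) [Field k] {s : ℕ} (i : Fin s) : SuperPoly k s :=
  ExteriorAlgebra.ι k (Pi.single i 1)

end SuperHopf

end

open SuperHopf

open scoped TensorProduct

noncomputable section

namespace SuperHopf

set_option linter.unusedSectionVars false

/-! ### Super-commutative algebras: sign rules, the `J`-adic filtration and its nilpotency -/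

section Basic

variable {k : Type*} [Field k] {A : Type*} [Ring A] [Algebra k A]
  (𝒜 : ZMod 2 → Submodule k A) [GradedAlgebra 𝒜]

/-! Write `J^n` for `radFilt 𝒜 n`, `ρ` for the coaction of `B` on `A`, `ε` for the counit and `S`
for the antipode of `B`. The odd components of finitely many algebra generators generate `J`, so `J`
is nilpotent and statements modulo `J^n` can be improved step by step. As `B` is purely even, no
signs survive in `ρ`: it is an algebra homomorphism into the ordinary tensor product.

Existence. A unital linear section `ψ` of `π` gives a retraction `r(a ⊗ b) = a₀ ψ(S(a₁) b)` of `ρ`.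
Since `ψ` is colinear modulo `J`, the failure of `r` to be colinear raises the filtration by one
(`defect_mem`). Replacing `m` by `m - r(ρ(m) - m ⊗ 1)` repeatedly turns an element invariant modulo
`J^n` into an invariant one (`exists_invariant`); no reductivity of `G` is needed. Evaluation pairs
`(J/J²)^G` with the odd derivations `A → k` at `ε`, and the pairing is nondegenerate on both sides
(`oddPointDer_eq_zero`, `mem_radFilt_two_of_oddPointDer`). These derivations are identified with
`𝔤_-` by left translation and give the `D'ᵢ` by right translation, so dual bases are an admissible
choice.

Structure. For an admissible choice with `Θ = span θ`, a nilpotent Nakayama argument gives `J = Θ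
A`, hence `J^(s+1) = 0`. Each `D'ᵢ θⱼ` is invariant, so it is congruent to its value `δᵢⱼ` at the
identity modulo `J`; therefore the even derivation `D` acts as `n` on `J^n/J^(n+1)`
(`euler_sub_smul_mem`). The integers `1, …, s` are invertible in `k`, so `ker D` meets `J` trivially
and represents every class modulo `J`, that is, `B̃ ≅ B`. Comparing `D'ᵢ` with `∂/∂θᵢ` shows that
`k[θ] → A` is injective, and climbing the filtration shows that `A = k[θ] B̃`.

Finally `D` is colinear, so `B̃` is a subcomodule. With `φ : B → B̃` inverse to `π`, the map `a ↦ a₀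
φ(S a₁)` is `A^G`-linear, fixes `A^G` and equals `ε` on `B̃`. It yields a left inverse of the
multiplication `A^G ⊗ B̃ → A` and forces `A^G = k[θ]`. -/

lemma proj_mem (i : ZMod 2) (a : A) : GradedAlgebra.proj 𝒜 i a ∈ 𝒜 i := by
  rw [GradedAlgebra.proj_apply]; exact SetLike.coe_mem _

lemma proj_of_mem {i : ZMod 2} {a : A} (ha : a ∈ 𝒜 i) : GradedAlgebra.proj 𝒜 i a = a := by
  rw [GradedAlgebra.proj_apply]; exact DirectSum.decompose_of_mem_same 𝒜 ha

lemma proj_of_mem_ne {i j : ZMod 2} {a : A} (ha : a ∈ 𝒜 i) (h : i ≠ j) :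
    GradedAlgebra.proj 𝒜 j a = 0 := by
  rw [GradedAlgebra.proj_apply]; exact DirectSum.decompose_of_mem_ne 𝒜 ha h

lemma proj_add_proj (a : A) : GradedAlgebra.proj 𝒜 0 a + GradedAlgebra.proj 𝒜 1 a = a := by
  classical
  conv_rhs => rw [← DirectSum.sum_support_decompose 𝒜 a]
  rw [Finset.sum_subset (Finset.subset_univ _)]
  · exact (Fin.sum_univ_two fun i => (DirectSum.decompose 𝒜 a i : A)).symm
  · intro i _ hi
    simpa using hi

lemma parity_of_even {a : A} (ha : a ∈ 𝒜 0) : parity 𝒜 a = a := by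
  simp [parity, proj_of_mem 𝒜 ha, proj_of_mem_ne 𝒜 ha (zero_ne_one)]

lemma parity_of_odd {a : A} (ha : a ∈ 𝒜 1) : parity 𝒜 a = -a := by
  simp [parity, proj_of_mem 𝒜 ha, proj_of_mem_ne 𝒜 ha (one_ne_zero)]

lemma parity_mem {i : ZMod 2} {a : A} (ha : a ∈ 𝒜 i) : parity 𝒜 a ∈ 𝒜 i := by
  fin_cases i
  · exact (parity_of_even 𝒜 ha).symm ▸ ha
  · exact (parity_of_odd 𝒜 ha).symm ▸ neg_mem ha

variable {𝒜} in
/-- Every element is the sum of an even and an odd one. -/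
lemma homogeneous_induction {P : A → Prop} (a : A) (h : ∀ i, ∀ a ∈ 𝒜 i, P a)
    (hadd : ∀ a b, P a → P b → P (a + b)) : P a := by
  rw [← proj_add_proj 𝒜 a]
  exact hadd _ _ (h 0 _ (proj_mem 𝒜 0 a)) (h 1 _ (proj_mem 𝒜 1 a))

lemma disjoint_even_odd {a : A} (h0 : a ∈ 𝒜 0) (h1 : a ∈ 𝒜 1) : a = 0 := by
  rw [← proj_of_mem 𝒜 h0, proj_of_mem_ne 𝒜 h1 one_ne_zero]

lemma mul_mem_add {i j : ZMod 2} {a b : A} (ha : a ∈ 𝒜 i) (hb : b ∈ 𝒜 j) :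
    a * b ∈ 𝒜 (i + j) := SetLike.mul_mem_graded ha hb

lemma one_mem_even : (1 : A) ∈ 𝒜 0 := SetLike.one_mem_graded 𝒜

lemma algebraMap_mem_even (r : k) : algebraMap k A r ∈ 𝒜 0 := by
  rw [Algebra.algebraMap_eq_smul_one]; exact Submodule.smul_mem _ _ (one_mem_even 𝒜)

lemma parity_mul (a b : A) : parity 𝒜 (a * b) = parity 𝒜 a * parity 𝒜 b := by
  induction a using homogeneous_induction (𝒜 := 𝒜) with
  | hadd x y hx hy => simp only [add_mul, map_add, hx, hy]
  | h i a ha =>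
  induction b using homogeneous_induction (𝒜 := 𝒜) with
  | hadd x y hx hy => simp only [mul_add, map_add, hx, hy]
  | h j b hb =>
  have hab := mul_mem_add 𝒜 ha hb
  fin_cases i <;> fin_cases j
  · rw [parity_of_even 𝒜 ha, parity_of_even 𝒜 hb, parity_of_even 𝒜 hab]
  · rw [parity_of_even 𝒜 ha, parity_of_odd 𝒜 hb, parity_of_odd 𝒜 hab, mul_neg]
  · rw [parity_of_odd 𝒜 ha, parity_of_even 𝒜 hb, parity_of_odd 𝒜 hab, neg_mul]
  · rw [parity_of_odd 𝒜 ha, parity_of_odd 𝒜 hb, parity_of_even 𝒜 (show a * b ∈ 𝒜 0 from hab),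
      neg_mul_neg]

lemma parity_parity (a : A) : parity 𝒜 (parity 𝒜 a) = a := by
  induction a using homogeneous_induction (𝒜 := 𝒜) with
  | hadd x y hx hy => simp only [map_add, hx, hy]
  | h i a ha =>
  fin_cases i
  · rw [parity_of_even 𝒜 ha, parity_of_even 𝒜 ha]
  · rw [parity_of_odd 𝒜 ha, map_neg, parity_of_odd 𝒜 ha, neg_neg]

variable [IsSuperCommutative 𝒜]

lemma odd_mul {o : A} (ho : o ∈ 𝒜 1) (a : A) : o * a = parity 𝒜 a * o := by
  induction a using homogeneous_induction (𝒜 := 𝒜) with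
  | hadd x y hx hy => simp only [mul_add, add_mul, map_add, hx, hy]
  | h i a ha =>
  fin_cases i
  · rw [parity_of_even 𝒜 ha]; exact (IsSuperCommutative.mul_comm_of_even 1 a ha o ho).symm
  · rw [parity_of_odd 𝒜 ha, neg_mul]; exact IsSuperCommutative.mul_comm_of_odd o ho a ha

lemma mul_odd {o : A} (ho : o ∈ 𝒜 1) (a : A) : a * o = o * parity 𝒜 a := by
  rw [odd_mul 𝒜 ho, parity_parity]

lemma even_mul_comm {b : A} (hb : b ∈ 𝒜 0) (a : A) : b * a = a * b := by
  induction a using homogeneous_induction (𝒜 := 𝒜) with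
  | hadd x y hx hy => simp only [mul_add, add_mul, hx, hy]
  | h i a ha => exact IsSuperCommutative.mul_comm_of_even i b hb a ha

lemma odd_mul_self (hk : ringChar k ≠ 2) {o : A} (ho : o ∈ 𝒜 1) : o * o = 0 := by
  have h := IsSuperCommutative.mul_comm_of_odd (𝒜 := 𝒜) o ho o ho
  have h2 : (2 : k) ≠ 0 := Ring.two_ne_zero hk
  have h3 : (2 : k) • (o * o) = 0 := by
    rw [two_smul]; nth_rewrite 1 [h]; exact neg_add_cancel _
  exact (smul_eq_zero.mp h3).resolve_left h2

/-- If `V` consists of odd elements, then `V` commutes with `⊤` as a subspace. -/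
lemma commute_top_of_le_odd {V : Submodule k A} (hV : V ≤ 𝒜 1) : Commute V ⊤ := by
  apply le_antisymm
  · refine Submodule.mul_le.2 fun v hv a _ => ?_
    rw [odd_mul 𝒜 (hV hv)]
    exact Submodule.mul_mem_mul trivial hv
  · refine Submodule.mul_le.2 fun a _ v hv => ?_
    rw [mul_odd 𝒜 (hV hv)]
    exact Submodule.mul_mem_mul hv trivial

/-- The `J`-adic filtration by `k`-subspaces. -/
def radFilt (n : ℕ) : Submodule k A := 𝒜 1 ^ n * ⊤

lemma top_mul_top : (⊤ : Submodule k A) * ⊤ = ⊤ := by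
  refine eq_top_iff.2 fun x _ => ?_
  simpa using Submodule.mul_mem_mul (show x ∈ (⊤ : Submodule k A) from trivial)
    (show (1 : A) ∈ (⊤ : Submodule k A) from trivial)

lemma radFilt_zero : radFilt 𝒜 0 = ⊤ := by simp [radFilt]

lemma radFilt_succ (n : ℕ) : radFilt 𝒜 (n + 1) = 𝒜 1 * radFilt 𝒜 n := by
  rw [radFilt, pow_succ', mul_assoc, radFilt]

lemma radFilt_mul (m n : ℕ) : radFilt 𝒜 m * radFilt 𝒜 n = radFilt 𝒜 (m + n) := by
  have h : Commute (⊤ : Submodule k A) (𝒜 1 ^ n) :=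
    ((commute_top_of_le_odd 𝒜 le_rfl).symm).pow_right n
  rw [radFilt, radFilt, radFilt, mul_assoc, ← mul_assoc ⊤, h.eq, mul_assoc, top_mul_top,
    ← mul_assoc, pow_add]

lemma mul_mem_radFilt {m n : ℕ} {a b : A} (ha : a ∈ radFilt 𝒜 m) (hb : b ∈ radFilt 𝒜 n) :
    a * b ∈ radFilt 𝒜 (m + n) := by
  rw [← radFilt_mul]; exact Submodule.mul_mem_mul ha hb

lemma mul_mem_radFilt_left {n : ℕ} (a : A) {b : A} (hb : b ∈ radFilt 𝒜 n) :
    a * b ∈ radFilt 𝒜 n := by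
  simpa using mul_mem_radFilt 𝒜 (m := 0) (a := a) (by simp [radFilt_zero]) hb

lemma mul_mem_radFilt_right {n : ℕ} {a : A} (b : A) (ha : a ∈ radFilt 𝒜 n) :
    a * b ∈ radFilt 𝒜 n := by
  simpa using mul_mem_radFilt 𝒜 (n := 0) (b := b) ha (by simp [radFilt_zero])

lemma radFilt_anti : Antitone (radFilt 𝒜) := by
  refine antitone_nat_of_succ_le fun n => ?_
  rw [radFilt_succ]
  exact Submodule.mul_le.2 fun a _ b hb => mul_mem_radFilt_left 𝒜 a hb

lemma odd_mem_radFilt {o : A} (ho : o ∈ 𝒜 1) : o ∈ radFilt 𝒜 1 := by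
  rw [radFilt, pow_one]
  simpa using Submodule.mul_mem_mul ho (show (1 : A) ∈ (⊤ : Submodule k A) from trivial)

lemma mem_superRadical {a : A} : a ∈ superRadical 𝒜 ↔ a ∈ radFilt 𝒜 1 := by
  constructor
  · intro h
    unfold superRadical at h
    induction h using Submodule.span_induction with
    | mem x hx => exact odd_mem_radFilt 𝒜 hx
    | zero => exact zero_mem _
    | add x y _ _ hx hy => exact add_mem hx hy
    | smul c x _ hx => exact mul_mem_radFilt_left 𝒜 c hx
  · intro h
    rw [radFilt, pow_one] at h
    induction h using Submodule.mul_induction_on' with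
    | mem_mul_mem m hm n _ =>
      exact Ideal.mul_mem_right _ _ (Ideal.subset_span hm)
    | add x _ y _ hx hy => exact add_mem hx hy

lemma mem_superRadical_sq {a : A} :
    a ∈ superRadical 𝒜 * superRadical 𝒜 ↔ a ∈ radFilt 𝒜 2 := by
  constructor
  · intro h
    refine Submodule.smul_induction_on (p := fun x => x ∈ radFilt 𝒜 2) h (fun m hm n hn => ?_)
      fun x y hx hy => add_mem hx hy
    have := mul_mem_radFilt 𝒜 ((mem_superRadical 𝒜).1 hm) ((mem_superRadical 𝒜).1 hn)
    rwa [one_add_one_eq_two] at this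
  · intro h
    rw [show 2 = 1 + 1 from rfl, ← radFilt_mul] at h
    induction h using Submodule.mul_induction_on' with
    | mem_mul_mem m hm n hn =>
      exact Ideal.mul_mem_mul ((mem_superRadical 𝒜).2 hm) ((mem_superRadical 𝒜).2 hn)
    | add x _ y _ hx hy => exact add_mem hx hy

/-- The homomorphism from the exterior algebra extending a linear map to the odd part. -/
def exteriorLift (hk : ringChar k ≠ 2) {V : Type*} [AddCommGroup V] [Module k V]
    (g : V →ₗ[k] A) (hg : ∀ v, g v ∈ 𝒜 1) : ExteriorAlgebra k V →ₐ[k] A :=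
  ExteriorAlgebra.lift k ⟨g, fun v => odd_mul_self 𝒜 hk (hg v)⟩

lemma exteriorLift_ι (hk : ringChar k ≠ 2) {V : Type*} [AddCommGroup V] [Module k V]
    (g : V →ₗ[k] A) (hg : ∀ v, g v ∈ 𝒜 1) (v : V) :
    exteriorLift 𝒜 hk g hg (ExteriorAlgebra.ι k v) = g v :=
  ExteriorAlgebra.lift_ι_apply k _ _ v

lemma range_ι_pow_eq_bot {V : Type*} [AddCommGroup V] [Module k V] [Module.Finite k V]
    {n : ℕ} (hn : Module.finrank k V < n) :
    (LinearMap.range (ExteriorAlgebra.ι k : V →ₗ[k] ExteriorAlgebra k V)) ^ n = ⊥ := by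
  have h : Module.finrank k (⋀[k]^n V) = 0 := by
    rw [exteriorPower.finrank_eq]; exact Nat.choose_eq_zero_of_lt hn
  exact Submodule.finrank_eq_zero.1 h

/-- Products of more than `dim V` elements of a space `V` of odd elements vanish. -/
lemma range_pow_eq_bot (hk : ringChar k ≠ 2) {V : Type*} [AddCommGroup V] [Module k V]
    [Module.Finite k V] (g : V →ₗ[k] A) (hg : ∀ v, g v ∈ 𝒜 1) {n : ℕ}
    (hn : Module.finrank k V < n) : (LinearMap.range g) ^ n = ⊥ := by
  have h : LinearMap.range g =
      (LinearMap.range (ExteriorAlgebra.ι k : V →ₗ[k] ExteriorAlgebra k V)).map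
        (exteriorLift 𝒜 hk g hg).toLinearMap := by
    rw [← LinearMap.range_comp]
    congr 1
    ext v
    exact (exteriorLift_ι 𝒜 hk g hg v).symm
  rw [h, ← Submodule.map_pow, range_ι_pow_eq_bot hn, Submodule.map_bot]

/-- If odd elements generate the odd part up to ideal multiples, they generate the filtration. -/
lemma radFilt_eq_of_odd_le {V : Submodule k A} (hV : V ≤ 𝒜 1) (h : radFilt 𝒜 1 ≤ V * ⊤) (n : ℕ) :
    radFilt 𝒜 n = V ^ n * ⊤ := by
  have h1 : radFilt 𝒜 1 = V * ⊤ := by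
    refine le_antisymm h ?_
    rw [radFilt, pow_one]
    exact mul_le_mul_left hV _
  induction n with
  | zero => simp [radFilt]
  | succ n ih =>
    have hc : Commute (⊤ : Submodule k A) (V ^ n) :=
      ((commute_top_of_le_odd 𝒜 hV).symm).pow_right n
    rw [add_comm, ← radFilt_mul, ih, h1, mul_assoc, ← mul_assoc ⊤, hc.eq, mul_assoc, top_mul_top,
      ← mul_assoc, add_comm, pow_succ']

/-- The radical of a finitely generated super-commutative algebra is nilpotent. -/
lemma exists_radFilt_eq_bot (hk : ringChar k ≠ 2) (hfg : Algebra.FiniteType k A) :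
    ∃ N, radFilt 𝒜 N = ⊥ := by
  classical
  obtain ⟨S, hS⟩ := hfg.out
  let g : (S → k) →ₗ[k] A := Fintype.linearCombination k (fun s : S => GradedAlgebra.proj 𝒜 1 (s : A))
  have hg : ∀ v, g v ∈ 𝒜 1 := fun v => by
    rw [Fintype.linearCombination_apply]
    exact sum_mem fun s _ => Submodule.smul_mem _ _ (proj_mem 𝒜 1 _)
  have hV : LinearMap.range g ≤ 𝒜 1 := by rintro _ ⟨v, rfl⟩; exact hg v
  let I : Submodule k A := LinearMap.range g * ⊤
  -- `I` is a two-sided ideal because odd elements commute with everything up to parity.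
  have hIr : ∀ a b, a ∈ I → a * b ∈ I := fun a b ha => by
    have := Submodule.mul_mem_mul ha (show b ∈ (⊤ : Submodule k A) from trivial)
    rwa [mul_assoc, top_mul_top] at this
  have hIl : ∀ a b, b ∈ I → a * b ∈ I := fun a b hb => by
    have := Submodule.mul_mem_mul (show a ∈ (⊤ : Submodule k A) from trivial) hb
    rwa [← mul_assoc, ← (commute_top_of_le_odd 𝒜 hV).eq, mul_assoc, top_mul_top] at this
  -- The odd part of `x y` is `x₀ y₁ + x₁ y₀`, so having odd part in `I` passes from the generators
  -- to all of `A`.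
  have key : ∀ a : A, GradedAlgebra.proj 𝒜 1 a ∈ I := by
    intro a
    have ha : a ∈ Algebra.adjoin k (S : Set A) := hS ▸ trivial
    induction ha using Algebra.adjoin_induction with
    | mem x hx =>
      have : GradedAlgebra.proj 𝒜 1 x = g (Pi.single ⟨x, hx⟩ 1) := by
        simp [g, Fintype.linearCombination_apply_single]
      rw [this]
      simpa using Submodule.mul_mem_mul (LinearMap.mem_range_self g (Pi.single ⟨x, hx⟩ 1))
        (show (1 : A) ∈ (⊤ : Submodule k A) from trivial)
    | algebraMap r => rw [proj_of_mem_ne 𝒜 (algebraMap_mem_even 𝒜 r) zero_ne_one]; exact zero_mem _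
    | add x y _ _ hx hy => rw [map_add]; exact add_mem hx hy
    | mul x y _ _ hx hy =>
      rw [← proj_add_proj 𝒜 x, add_mul, map_add]
      refine add_mem ?_ ?_
      · rw [← proj_add_proj 𝒜 y, mul_add, map_add,
          proj_of_mem_ne 𝒜 (mul_mem_add 𝒜 (proj_mem 𝒜 0 x) (proj_mem 𝒜 0 y))
            (by decide : (0 : ZMod 2) + 0 ≠ 1), zero_add,
          proj_of_mem 𝒜 (by simpa using mul_mem_add 𝒜 (proj_mem 𝒜 0 x) (proj_mem 𝒜 1 y))]
        exact hIl _ _ hy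
      · rw [← proj_add_proj 𝒜 y, mul_add, map_add,
          proj_of_mem_ne 𝒜 (mul_mem_add 𝒜 (proj_mem 𝒜 1 x) (proj_mem 𝒜 1 y))
            (by decide : (1 : ZMod 2) + 1 ≠ 1), add_zero,
          proj_of_mem 𝒜 (by simpa using mul_mem_add 𝒜 (proj_mem 𝒜 1 x) (proj_mem 𝒜 0 y))]
        exact hIr _ _ hx
  have h1 : radFilt 𝒜 1 ≤ I := by
    rw [radFilt, pow_one]
    refine Submodule.mul_le.2 fun o ho a _ => hIr _ _ ?_
    rw [← proj_of_mem 𝒜 ho]; exact key o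
  refine ⟨Module.finrank k (S → k) + 1, ?_⟩
  rw [radFilt_eq_of_odd_le 𝒜 hV h1, range_pow_eq_bot 𝒜 hk g hg (Nat.lt_succ_self _)]
  exact Submodule.bot_mul _

end Basic

/-! ### The subspaces `V ⊗ B` of `A ⊗ B` -/

section TensorTop

variable {k : Type*} [Field k] {A B : Type*} [Ring A] [Algebra k A] [Ring B] [Algebra k B]

/-- The subspace `V ⊗ B` of `A ⊗ B`. -/
def tensorTop (B : Type*) [Ring B] [Algebra k B] (V : Submodule k A) : Submodule k (A ⊗[k] B) :=
  Submodule.map₂ (TensorProduct.mk k A B) V ⊤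

lemma tmul_mem_tensorTop {V : Submodule k A} {a : A} (ha : a ∈ V) (b : B) :
    a ⊗ₜ[k] b ∈ tensorTop B V :=
  Submodule.apply_mem_map₂ (TensorProduct.mk k A B) ha trivial

lemma tensorTop_induction {V : Submodule k A} {P : (u : A ⊗[k] B) → u ∈ tensorTop B V → Prop}
    (zero : P 0 (zero_mem _))
    (tmul : ∀ a (ha : a ∈ V) b, P (a ⊗ₜ b) (tmul_mem_tensorTop ha b))
    (add : ∀ u v hu hv, P u hu → P v hv → P (u + v) (add_mem hu hv))
    {u : A ⊗[k] B} (hu : u ∈ tensorTop B V) : P u hu := by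
  have hu' : u ∈ Submodule.span k (Set.image2 (fun m n => TensorProduct.mk k A B m n)
      (V : Set A) ((⊤ : Submodule k B) : Set B)) := by
    rwa [← Submodule.map₂_eq_span_image2]
  suffices h : ∃ h, P u h from h.2
  clear hu
  induction hu' using Submodule.closure_induction with
  | zero => exact ⟨_, zero⟩
  | add x y _ _ hx hy => exact ⟨_, add x y _ _ hx.2 hy.2⟩
  | smul_mem r x hx =>
    obtain ⟨a, ha, b, _, rfl⟩ := hx
    have := tmul (r • a) (V.smul_mem r ha) b
    simp only [← TensorProduct.smul_tmul'] at this
    exact ⟨_, this⟩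

lemma tensorTop_top : tensorTop B (⊤ : Submodule k A) = ⊤ := TensorProduct.map₂_mk_top_top_eq_top k A B

lemma tensorTop_bot : tensorTop B (⊥ : Submodule k A) = ⊥ := Submodule.map₂_bot_left _ _

lemma mul_mem_tensorTop {V W : Submodule k A} {u v : A ⊗[k] B} (hu : u ∈ tensorTop B V)
    (hv : v ∈ tensorTop B W) : u * v ∈ tensorTop B (V * W) := by
  induction hu using tensorTop_induction with
  | zero => simp
  | add x y _ _ hx hy => rw [add_mul]; exact add_mem hx hy
  | tmul a ha b =>
  induction hv using tensorTop_induction with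
  | zero => simp
  | add x y _ _ hx hy => rw [mul_add]; exact add_mem hx hy
  | tmul a' ha' b' =>
    rw [Algebra.TensorProduct.tmul_mul_tmul]
    exact tmul_mem_tensorTop (Submodule.mul_mem_mul ha ha') _

lemma mul_one_tmul_mem_tensorTop {V : Submodule k A} {u : A ⊗[k] B} (hu : u ∈ tensorTop B V)
    (b : B) : u * (1 ⊗ₜ b) ∈ tensorTop B V := by
  induction hu using tensorTop_induction with
  | zero => simp
  | add x y _ _ hx hy => rw [add_mul]; exact add_mem hx hy
  | tmul a ha b =>
    rw [Algebra.TensorProduct.tmul_mul_tmul, mul_one]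
    exact tmul_mem_tensorTop ha _

lemma lTensor_mem_tensorTop {V : Submodule k A} {C : Type*} [Ring C] [Algebra k C]
    (g : B →ₗ[k] C) {u : A ⊗[k] B} (hu : u ∈ tensorTop B V) :
    g.lTensor A u ∈ tensorTop C V := by
  induction hu using tensorTop_induction with
  | zero => simp
  | add x y _ _ hx hy => rw [map_add]; exact add_mem hx hy
  | tmul a ha b => exact tmul_mem_tensorTop ha _

/-- Right exactness of the tensor product identifies the kernel of `g ⊗ id` with the image of `ker g
⊗ B`. -/
lemma mem_tensorTop_of_rTensor_eq_zero {M : Type*} [AddCommGroup M] [Module k M] (g : A →ₗ[k] M)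
    (hg : Function.Surjective g) {u : A ⊗[k] B} (hu : g.rTensor B u = 0) :
    u ∈ tensorTop B (LinearMap.ker g) := by
  have hex : Function.Exact (LinearMap.ker g).subtype g := LinearMap.exact_subtype_ker_map g
  obtain ⟨t, rfl⟩ := (rTensor_exact B hex hg u).1 hu
  induction t with
  | zero => simp
  | add x y hx hy =>
    rw [map_add]
    refine add_mem (hx ?_) (hy ?_) <;>
    · rw [← LinearMap.comp_apply, ← LinearMap.rTensor_comp, LinearMap.comp_ker_subtype]
      simp
  | tmul a b => exact tmul_mem_tensorTop a.2 b

end TensorTop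

/-! ### Coactions of an even quotient Hopf algebra and the lifting of invariants -/

section Hopf

variable {k : Type*} [Field k] {A : Type*} [Ring A] [Algebra k A]
  (𝒜 : ZMod 2 → Submodule k A) [GradedAlgebra 𝒜] [IsSuperCommutative 𝒜]
  (B : Type*) [Ring B] [Algebra k B]

/-- The purely even Hopf algebra `B = A / J` together with its coaction on `A`. -/
structure EvenQuotient where
  /-- the quotient map -/
  pi : A →ₐ[k] B
  /-- the coaction on `A` -/
  coact : A →ₐ[k] A ⊗[k] B
  /-- the comultiplication of the quotient -/
  comul : B →ₐ[k] B ⊗[k] B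
  /-- the counit of the quotient -/
  counit : B →ₐ[k] k
  /-- the antipode of the quotient -/
  antipode : B →ₐ[k] B
  mul_comm : ∀ b c : B, b * c = c * b
  pi_surjective : Function.Surjective pi
  ker_pi : LinearMap.ker pi.toLinearMap = radFilt 𝒜 1
  pi_coact : ∀ a, pi.toLinearMap.rTensor B (coact a) = comul (pi a)
  coassoc : ∀ a, TensorProduct.assoc k A B B (coact.toLinearMap.rTensor B (coact a)) =
    comul.toLinearMap.lTensor A (coact a)
  counit_coact : ∀ a, counit.toLinearMap.lTensor A (coact a) = a ⊗ₜ 1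
  coact_mem : ∀ i, ∀ a ∈ 𝒜 i, coact a ∈ tensorTop B (𝒜 i)
  antipode_left : ∀ b, LinearMap.mul' k B (antipode.toLinearMap.rTensor B (comul b)) =
    algebraMap k B (counit b)
  antipode_right : ∀ b, LinearMap.mul' k B (antipode.toLinearMap.lTensor B (comul b)) =
    algebraMap k B (counit b)

namespace EvenQuotient

variable {𝒜 B} (H : EvenQuotient 𝒜 B)

/-- `ρ` is multiplicative and maps odd elements into `A_- ⊗ B`, so every power of `J` is a
subcomodule. -/
lemma coact_radFilt (n : ℕ) {a : A} (ha : a ∈ radFilt 𝒜 n) :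
    H.coact a ∈ tensorTop B (radFilt 𝒜 n) := by
  induction n generalizing a with
  | zero => rw [radFilt_zero, tensorTop_top]; trivial
  | succ n ih =>
    rw [radFilt_succ] at ha ⊢
    induction ha using Submodule.mul_induction_on' with
    | mem_mul_mem o ho b hb =>
      rw [map_mul]; exact mul_mem_tensorTop (H.coact_mem 1 o ho) (ih hb)
    | add x _ y _ hx hy => rw [map_add]; exact add_mem hx hy

lemma mem_tensorTop_of_pi {u : A ⊗[k] B} (hu : H.pi.toLinearMap.rTensor B u = 0) :
    u ∈ tensorTop B (radFilt 𝒜 1) := by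
  rw [← H.ker_pi]
  exact mem_tensorTop_of_rTensor_eq_zero _ H.pi_surjective hu

/-- `a ⊗ b ↦ ρ(a) (1 ⊗ b)`. -/
def can : A ⊗[k] B →ₗ[k] A ⊗[k] B :=
  LinearMap.mul' k (A ⊗[k] B) ∘ₗ
    TensorProduct.map H.coact.toLinearMap
      (Algebra.TensorProduct.includeRight : B →ₐ[k] A ⊗[k] B).toLinearMap

/-- `a ⊗ b ↦ (1 ⊗ S)(ρ(a)) (1 ⊗ b)`, the inverse of `can`. -/
def canInv : A ⊗[k] B →ₗ[k] A ⊗[k] B :=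
  LinearMap.mul' k (A ⊗[k] B) ∘ₗ
    TensorProduct.map (H.antipode.toLinearMap.lTensor A ∘ₗ H.coact.toLinearMap)
      (Algebra.TensorProduct.includeRight : B →ₐ[k] A ⊗[k] B).toLinearMap

@[simp] lemma can_tmul (a : A) (b : B) : H.can (a ⊗ₜ b) = H.coact a * (1 ⊗ₜ b) := rfl

@[simp] lemma canInv_tmul (a : A) (b : B) :
    H.canInv (a ⊗ₜ b) = H.antipode.toLinearMap.lTensor A (H.coact a) * (1 ⊗ₜ b) := rfl

lemma can_mul (t : A ⊗[k] B) (b : B) : H.can (t * (1 ⊗ₜ b)) = H.can t * (1 ⊗ₜ b) := by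
  induction t with
  | zero => simp
  | add x y hx hy => simp only [add_mul, map_add, hx, hy]
  | tmul a c =>
    rw [Algebra.TensorProduct.tmul_mul_tmul, mul_one, can_tmul, can_tmul, mul_assoc,
      Algebra.TensorProduct.tmul_mul_tmul, mul_one]

lemma canInv_mul (t : A ⊗[k] B) (b : B) : H.canInv (t * (1 ⊗ₜ b)) = H.canInv t * (1 ⊗ₜ b) := by
  induction t with
  | zero => simp
  | add x y hx hy => simp only [add_mul, map_add, hx, hy]
  | tmul a c =>
    rw [Algebra.TensorProduct.tmul_mul_tmul, mul_one, canInv_tmul, canInv_tmul, mul_assoc,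
      Algebra.TensorProduct.tmul_mul_tmul, mul_one]

/-- Coassociativity rewrites `a₀ ⊗ φ(a₁ ⊗ a₂)` as `a₀ ⊗ φ(Δ a₁)`. Taking for `φ` either `S(b) c` or
`b S(c)` makes `can` and `canInv` inverse to each other on both sides. -/
lemma lTensor_mul_antipode_coact (φ : B ⊗[k] B →ₗ[k] B)
    (hφ : ∀ b, φ (H.comul b) = algebraMap k B (H.counit b)) (a : A) :
    φ.lTensor A (TensorProduct.assoc k A B B (H.coact.toLinearMap.rTensor B (H.coact a))) =
      a ⊗ₜ 1 := by
  have h1 : φ ∘ₗ H.comul.toLinearMap = Algebra.linearMap k B ∘ₗ H.counit.toLinearMap := by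
    ext b; exact hφ b
  rw [H.coassoc, ← LinearMap.comp_apply, ← LinearMap.lTensor_comp, h1, LinearMap.lTensor_comp,
    LinearMap.comp_apply, H.counit_coact]
  simp

lemma canInv_can (t : A ⊗[k] B) : H.canInv (H.can t) = t := by
  have key : ∀ t : A ⊗[k] B, H.canInv t =
      (LinearMap.mul' k B ∘ₗ H.antipode.toLinearMap.rTensor B).lTensor A
        (TensorProduct.assoc k A B B (H.coact.toLinearMap.rTensor B t)) := by
    intro t
    induction t with
    | zero => simp
    | add x y hx hy => simp only [map_add, hx, hy]
    | tmul a b =>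
      simp only [canInv_tmul, LinearMap.rTensor_tmul, AlgHom.toLinearMap_apply]
      induction H.coact a with
      | zero => simp
      | add x y hx hy => simp only [map_add, add_mul, TensorProduct.add_tmul, hx, hy]
      | tmul x c => simp
  induction t with
  | zero => simp
  | add x y hx hy => simp only [map_add, hx, hy]
  | tmul a b =>
    rw [can_tmul, canInv_mul, key, H.lTensor_mul_antipode_coact]
    · simp
    · exact H.antipode_left

lemma can_canInv (t : A ⊗[k] B) : H.can (H.canInv t) = t := by
  have key : ∀ t : A ⊗[k] B, H.can (H.antipode.toLinearMap.lTensor A t) =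
      (LinearMap.mul' k B ∘ₗ H.antipode.toLinearMap.lTensor B).lTensor A
        (TensorProduct.assoc k A B B (H.coact.toLinearMap.rTensor B t)) := by
    intro t
    induction t with
    | zero => simp
    | add x y hx hy => simp only [map_add, hx, hy]
    | tmul a b =>
      simp only [can_tmul, LinearMap.rTensor_tmul, LinearMap.lTensor_tmul,
        AlgHom.toLinearMap_apply]
      induction H.coact a with
      | zero => simp
      | add x y hx hy => simp only [map_add, add_mul, TensorProduct.add_tmul, hx, hy]
      | tmul x c => simp
  induction t with
  | zero => simp
  | add x y hx hy => simp only [map_add, hx, hy]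
  | tmul a b =>
    rw [canInv_tmul, can_mul, key, H.lTensor_mul_antipode_coact]
    · simp
    · exact H.antipode_right

lemma canInv_mem {n : ℕ} {u : A ⊗[k] B} (hu : u ∈ tensorTop B (radFilt 𝒜 n)) :
    H.canInv u ∈ tensorTop B (radFilt 𝒜 n) := by
  induction hu using tensorTop_induction with
  | zero => simp
  | add x y _ _ hx hy => rw [map_add]; exact add_mem hx hy
  | tmul a ha b =>
    exact mul_one_tmul_mem_tensorTop (lTensor_mem_tensorTop _ (H.coact_radFilt n ha)) b

/-- A linear section of the projection preserves the unit without loss of generality. -/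
lemma exists_section : ∃ ψ : B →ₗ[k] A, ψ 1 = 1 ∧ ∀ b, H.pi (ψ b) = b := by
  obtain ⟨ψ, hψ⟩ := H.pi.toLinearMap.exists_rightInverse_of_surjective
    (LinearMap.range_eq_top.2 H.pi_surjective)
  have hψ' : ∀ b, H.pi (ψ b) = b := fun b => LinearMap.congr_fun hψ b
  refine ⟨ψ + H.counit.toLinearMap.smulRight (1 - ψ 1), ?_, fun b => ?_⟩
  · simp
  · simp [hψ']

/-- The retraction of the coaction attached to a linear section of the projection. -/
def retract (ψ : B →ₗ[k] A) : A ⊗[k] B →ₗ[k] A :=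
  LinearMap.mul' k A ∘ₗ ψ.lTensor A ∘ₗ H.canInv

lemma retract_can (ψ : B →ₗ[k] A) (a : A) (b : B) :
    H.retract ψ (H.coact a * (1 ⊗ₜ b)) = a * ψ b := by
  rw [← can_tmul, retract, LinearMap.comp_apply, LinearMap.comp_apply, canInv_can]
  simp

lemma retract_coact (ψ : B →ₗ[k] A) (hψ : ψ 1 = 1) (a : A) : H.retract ψ (H.coact a) = a := by
  have := H.retract_can ψ a 1
  rwa [← Algebra.TensorProduct.one_def, mul_one, hψ, mul_one] at this

lemma mul'_lTensor_mem (ψ : B →ₗ[k] A) {n : ℕ} {u : A ⊗[k] B}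
    (hu : u ∈ tensorTop B (radFilt 𝒜 n)) :
    LinearMap.mul' k A (ψ.lTensor A u) ∈ radFilt 𝒜 n := by
  induction hu using tensorTop_induction with
  | zero => simp
  | add x y _ _ hx hy => rw [map_add, map_add]; exact add_mem hx hy
  | tmul a ha b => exact mul_mem_radFilt_right 𝒜 _ ha

lemma retract_mem (ψ : B →ₗ[k] A) {n : ℕ} {u : A ⊗[k] B} (hu : u ∈ tensorTop B (radFilt 𝒜 n)) :
    H.retract ψ u ∈ radFilt 𝒜 n := mul'_lTensor_mem ψ (H.canInv_mem hu)

/-- The failure of colinearity of `retract`. -/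
def defect (ψ : B →ₗ[k] A) : A ⊗[k] B →ₗ[k] A ⊗[k] B :=
  (H.retract ψ).rTensor B ∘ₗ (TensorProduct.assoc k A B B).symm.toLinearMap ∘ₗ
    H.comul.toLinearMap.lTensor A - H.coact.toLinearMap ∘ₗ H.retract ψ

/-- Since `can` is bijective, `r` is determined by `r(ρ(a)(1 ⊗ b)) = a ψ(b)`; here that rule is
applied with one further tensor factor `B` carried along. -/
lemma rTensor_retract (ψ : B →ₗ[k] A) (t : A ⊗[k] B) (w : B ⊗[k] B) :
    (H.retract ψ).rTensor B (H.coact.toLinearMap.rTensor B t *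
      (TensorProduct.assoc k A B B).symm (1 ⊗ₜ w)) = t * ψ.rTensor B w := by
  induction t with
  | zero => simp
  | add x y hx hy => simp only [map_add, add_mul, hx, hy]
  | tmul a c =>
  induction w with
  | zero => simp
  | add x y hx hy => simp only [map_add, mul_add, TensorProduct.tmul_add, hx, hy]
  | tmul b d =>
    simp only [LinearMap.rTensor_tmul, TensorProduct.assoc_symm_tmul, AlgHom.toLinearMap_apply,
      Algebra.TensorProduct.tmul_mul_tmul, H.retract_can]

/-- In the coordinates given by `can`, `r` is `a ⊗ b ↦ a ψ(b)`, so its lack of colinearity is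
exactly that of `ψ`, multiplied by `ρ(a)`. -/
lemma defect_can (ψ : B →ₗ[k] A) (a : A) (b : B) :
    H.defect ψ (H.coact a * (1 ⊗ₜ b)) =
      H.coact a * (ψ.rTensor B (H.comul b) - H.coact (ψ b)) := by
  have h1 : ∀ t : A ⊗[k] B, H.comul.toLinearMap.lTensor A (t * (1 ⊗ₜ b)) =
      H.comul.toLinearMap.lTensor A t * (1 ⊗ₜ H.comul b) := by
    intro t
    induction t with
    | zero => simp
    | add x y hx hy => simp only [map_add, add_mul, hx, hy]
    | tmul a c => simp
  have h2 : ∀ x y : A ⊗[k] (B ⊗[k] B), (TensorProduct.assoc k A B B).symm (x * y) =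
      (TensorProduct.assoc k A B B).symm x * (TensorProduct.assoc k A B B).symm y :=
    fun x y => map_mul (Algebra.TensorProduct.assoc k k k A B B).symm x y
  have h3 := H.coassoc a
  simp only [defect, LinearMap.sub_apply, LinearMap.comp_apply, LinearEquiv.coe_coe,
    AlgHom.toLinearMap_apply, h1, h2, ← h3, LinearEquiv.symm_apply_apply, H.rTensor_retract,
    H.retract_can, map_mul, mul_sub]

/-- After applying `π ⊗ id` both terms become `Δ_B(b)`, as `π` is colinear and `ψ` is a section of
it. -/
lemma section_defect_mem {ψ : B →ₗ[k] A} (hψ : ∀ b, H.pi (ψ b) = b) (b : B) :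
    ψ.rTensor B (H.comul b) - H.coact (ψ b) ∈ tensorTop B (radFilt 𝒜 1) := by
  apply H.mem_tensorTop_of_pi
  have : H.pi.toLinearMap ∘ₗ ψ = LinearMap.id := by ext b; exact hψ b
  rw [map_sub, ← LinearMap.comp_apply, ← LinearMap.rTensor_comp, this, H.pi_coact, hψ]
  simp

/-- The gain of one step drives every successive approximation: `ρ(a)` keeps the degree `n` of `a`,
and the defect of `ψ` contributes one more factor from `J`. -/
lemma defect_mem {ψ : B →ₗ[k] A} (hψ : ∀ b, H.pi (ψ b) = b) {n : ℕ} {u : A ⊗[k] B}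
    (hu : u ∈ tensorTop B (radFilt 𝒜 n)) : H.defect ψ u ∈ tensorTop B (radFilt 𝒜 (n + 1)) := by
  rw [← H.can_canInv u]
  have hu' := H.canInv_mem hu
  generalize H.canInv u = w at hu' ⊢
  induction hu' using tensorTop_induction with
  | zero => simp
  | add x y _ _ hx hy => rw [map_add, map_add]; exact add_mem hx hy
  | tmul a ha b =>
    rw [can_tmul, defect_can, ← radFilt_mul]
    exact mul_mem_tensorTop (H.coact_radFilt n ha) (H.section_defect_mem hψ b)

/-- Correcting an almost invariant element by `retract` improves its invariance. -/
lemma coact_sub_retract {ψ : B →ₗ[k] A} (hψ1 : ψ 1 = 1) (m : A) :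
    H.coact (m - H.retract ψ (H.coact m - m ⊗ₜ 1)) -
      (m - H.retract ψ (H.coact m - m ⊗ₜ 1)) ⊗ₜ 1 = H.defect ψ (H.coact m - m ⊗ₜ 1) := by
  have h3 := H.coassoc m
  have h4 : ∀ u : A ⊗[k] B, (H.retract ψ).rTensor B (H.coact.toLinearMap.rTensor B u) = u := by
    intro u
    have : H.retract ψ ∘ₗ H.coact.toLinearMap = LinearMap.id := by
      ext a; exact H.retract_coact ψ hψ1 a
    rw [← LinearMap.comp_apply, ← LinearMap.rTensor_comp, this]; simp
  simp only [defect, LinearMap.sub_apply, LinearMap.comp_apply, LinearEquiv.coe_coe, map_sub,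
    ← h3, LinearEquiv.symm_apply_apply, h4, LinearMap.lTensor_tmul, AlgHom.toLinearMap_apply,
    map_one, Algebra.TensorProduct.one_def, TensorProduct.assoc_symm_tmul, LinearMap.rTensor_tmul,
    H.retract_coact ψ hψ1, TensorProduct.sub_tmul]
  abel

/-- Almost invariant elements lift to invariant ones. -/
lemma exists_invariant {N : ℕ} (hN : radFilt 𝒜 N = ⊥) (n : ℕ) (m : A)
    (hm : H.coact m - m ⊗ₜ 1 ∈ tensorTop B (radFilt 𝒜 n)) :
    ∃ m', m' - m ∈ radFilt 𝒜 n ∧ H.coact m' = m' ⊗ₜ 1 := by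
  obtain ⟨ψ, hψ1, hψ⟩ := H.exists_section
  -- Descending induction on `n` through a bound `d` for `N - n`; once `n ≥ N` the error space is
  -- zero.
  obtain ⟨d, hd⟩ : ∃ d, N ≤ n + d := ⟨N, Nat.le_add_left _ _⟩
  induction d generalizing n m with
  | zero =>
    have h0 : radFilt 𝒜 n = ⊥ := le_bot_iff.1 (hN ▸ radFilt_anti 𝒜 hd)
    rw [h0, tensorTop_bot, Submodule.mem_bot, sub_eq_zero] at hm
    exact ⟨m, by simp, hm⟩
  | succ d ih =>
    obtain ⟨m', h1, h2⟩ := ih (n + 1) (m - H.retract ψ (H.coact m - m ⊗ₜ 1))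
      (by rw [H.coact_sub_retract hψ1]; exact H.defect_mem hψ hm) (by omega)
    refine ⟨m', ?_, h2⟩
    have h3 := sub_mem (radFilt_anti 𝒜 (Nat.le_succ n) h1) (H.retract_mem ψ hm)
    convert h3 using 1
    abel

/-- The defect of `r` at `a ⊗ 1` is `r(a ⊗ 1) ⊗ 1 - ρ(r(a ⊗ 1))`. Thus `a ↦ r(a ⊗ 1)` maps `J^n` to
elements invariant modulo `J^(n+1)`. -/
lemma invariant_defect {ψ : B →ₗ[k] A} (hψ : ∀ b, H.pi (ψ b) = b) {n : ℕ} {a : A}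
    (ha : a ∈ radFilt 𝒜 n) :
    H.coact (H.retract ψ (a ⊗ₜ 1)) - H.retract ψ (a ⊗ₜ 1) ⊗ₜ 1 ∈
      tensorTop B (radFilt 𝒜 (n + 1)) := by
  have := neg_mem (H.defect_mem hψ (tmul_mem_tensorTop ha (1 : B)))
  simpa [defect, Algebra.TensorProduct.one_def] using this

/-- `J` is generated modulo `J²` by the elements `retract (a ⊗ 1)`. -/
lemma radFilt_one_le {ψ : B →ₗ[k] A} (hψ1 : ψ 1 = 1) (hψ : ∀ b, H.pi (ψ b) = b)
    {V : Submodule k A} (hV : ∀ a ∈ radFilt 𝒜 1, H.retract ψ (a ⊗ₜ 1) ∈ V) :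
    radFilt 𝒜 1 ≤ V * ⊤ ⊔ radFilt 𝒜 2 := by
  have key : ∀ u ∈ tensorTop B (radFilt 𝒜 1), H.retract ψ u ∈ V * ⊤ ⊔ radFilt 𝒜 2 := by
    intro u hu
    induction hu using tensorTop_induction with
    | zero => simp
    | add x y _ _ hx hy => rw [map_add]; exact add_mem hx hy
    | tmul a ha b =>
      -- `ψ` is multiplicative modulo `J` and the factor `a₀` lies in `J`, so `r(a ⊗ b)` and `r(a ⊗
      -- 1) ψ(b)` agree modulo `J²`.
      rw [show H.retract ψ (a ⊗ₜ b) = H.retract ψ (a ⊗ₜ 1) * ψ b +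
        (H.retract ψ (a ⊗ₜ b) - H.retract ψ (a ⊗ₜ 1) * ψ b) by abel]
      refine add_mem (Submodule.mem_sup_left (Submodule.mul_mem_mul (hV a ha) trivial))
        (Submodule.mem_sup_right ?_)
      simp only [retract, LinearMap.comp_apply, canInv_tmul, ← Algebra.TensorProduct.one_def,
        mul_one]
      have hv := lTensor_mem_tensorTop H.antipode.toLinearMap (H.coact_radFilt 1 ha)
      generalize H.antipode.toLinearMap.lTensor A (H.coact a) = w at hv ⊢
      induction hv using tensorTop_induction with
      | zero => simp
      | add x y _ _ hx hy =>
        simp only [map_add, add_mul] at hx hy ⊢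
        convert add_mem hx hy using 1; abel
      | tmul x hx c =>
        simp only [Algebra.TensorProduct.tmul_mul_tmul, mul_one, LinearMap.lTensor_tmul,
          LinearMap.mul'_apply, mul_assoc, ← mul_sub]
        have h : ψ (c * b) - ψ c * ψ b ∈ radFilt 𝒜 1 := by
          rw [← H.ker_pi]; simp [hψ]
        have := mul_mem_radFilt 𝒜 hx h
        rwa [one_add_one_eq_two] at this
  intro a ha
  rw [← H.retract_coact ψ hψ1 a]
  exact key _ (H.coact_radFilt 1 ha)

/-- Obtained by applying `r` to `ρ(a) - a ⊗ 1`: the projection `r(· ⊗ 1)` fixes almost invariant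
elements up to the same error. -/
lemma retract_sub_mem {ψ : B →ₗ[k] A} (hψ1 : ψ 1 = 1) {n : ℕ} {a : A}
    (ha : H.coact a - a ⊗ₜ 1 ∈ tensorTop B (radFilt 𝒜 n)) :
    a - H.retract ψ (a ⊗ₜ 1) ∈ radFilt 𝒜 n := by
  have := H.retract_mem ψ ha
  rwa [map_sub, H.retract_coact ψ hψ1] at this

lemma pi_mul'_coact {ψ : B →ₗ[k] A} (hψ : ∀ b, H.pi (ψ b) = b) (a : A) :
    H.pi (LinearMap.mul' k A (ψ.lTensor A (H.antipode.toLinearMap.lTensor A (H.coact a)))) =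
      algebraMap k B (H.counit (H.pi a)) := by
  rw [← H.antipode_right, ← H.pi_coact]
  induction H.coact a with
  | zero => simp
  | add x y hx hy => simp only [map_add, hx, hy]
  | tmul x b => simp [hψ]

/-- Modulo `J²`, `r(ab ⊗ 1)` is `a₀ (b₀ ψ(S b₁)) ψ(S a₁)`. The middle factor maps to `ε(b) = 0` in
`B`, so it lies in `J` alongside `a₀`. Hence `r(· ⊗ 1)` on `J` modulo `J²` only sees behaviour to
first order at the identity. -/
lemma retract_mul_mem {ψ : B →ₗ[k] A} (hψ : ∀ b, H.pi (ψ b) = b) {a b : A}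
    (ha : a ∈ radFilt 𝒜 1) (hb : H.counit (H.pi b) = 0) :
    H.retract ψ ((a * b) ⊗ₜ 1) ∈ radFilt 𝒜 2 := by
  have hb' : LinearMap.mul' k A (ψ.lTensor A (H.antipode.toLinearMap.lTensor A (H.coact b))) ∈
      radFilt 𝒜 1 := by
    rw [← H.ker_pi, LinearMap.mem_ker, AlgHom.toLinearMap_apply, H.pi_mul'_coact hψ, hb, map_zero]
  have hmul : ∀ u v : A ⊗[k] B, H.antipode.toLinearMap.lTensor A (u * v) =
      H.antipode.toLinearMap.lTensor A u * H.antipode.toLinearMap.lTensor A v := fun u v =>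
    map_mul (Algebra.TensorProduct.map (AlgHom.id k A) H.antipode) u v
  simp only [retract, LinearMap.comp_apply, canInv_tmul, ← Algebra.TensorProduct.one_def,
        mul_one, map_mul, hmul]
  have hv := lTensor_mem_tensorTop H.antipode.toLinearMap (H.coact_radFilt 1 ha)
  generalize H.antipode.toLinearMap.lTensor A (H.coact a) = w at hv ⊢
  induction hv using tensorTop_induction with
  | zero => simp
  | add x y _ _ hx hy => simp only [map_add, add_mul]; exact add_mem hx hy
  | tmul x hx c =>
    have key : ∀ w : A ⊗[k] B, LinearMap.mul' k A (ψ.lTensor A ((x ⊗ₜ c) * w)) -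
        x * LinearMap.mul' k A (ψ.lTensor A w) * ψ c ∈ radFilt 𝒜 2 := by
      intro w
      induction w with
      | zero => simp
      | add u v hu hv =>
        simp only [map_add, add_mul, mul_add] at hu hv ⊢
        convert add_mem hu hv using 1; abel
      | tmul y d =>
        simp only [Algebra.TensorProduct.tmul_mul_tmul, LinearMap.lTensor_tmul,
          LinearMap.mul'_apply, mul_assoc, ← mul_sub]
        have h : y * (ψ (c * d) - ψ d * ψ c) ∈ radFilt 𝒜 1 := by
          refine mul_mem_radFilt_left 𝒜 _ ?_
          rw [← H.ker_pi]; simp [hψ, H.mul_comm c d]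
        have := mul_mem_radFilt 𝒜 hx h
        rwa [one_add_one_eq_two] at this
    have h2 := mul_mem_radFilt_right 𝒜 (ψ c) (mul_mem_radFilt 𝒜 hx hb')
    rw [one_add_one_eq_two] at h2
    have := add_mem (key (H.antipode.toLinearMap.lTensor A (H.coact b))) h2
    rwa [sub_add_cancel] at this

end EvenQuotient

end Hopf

/-! ### The Hopf algebra `B = A / J` and its coaction on `A` -/

section Construction

variable {k : Type*} [Field k] {A : Type*} [Ring A] [Algebra k A]
  (𝒜 : ZMod 2 → Submodule k A) [GradedAlgebra 𝒜]

lemma tensorGrading_induction {i : ZMod 2} {P : A ⊗[k] A → Prop} (zero : P 0)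
    (tmul : ∀ p q, p + q = i → ∀ a ∈ 𝒜 p, ∀ b ∈ 𝒜 q, P (a ⊗ₜ b))
    (add : ∀ u v, P u → P v → P (u + v)) {t : A ⊗[k] A}
    (ht : GradedTensorProduct.of k 𝒜 𝒜 t ∈ tensorGrading 𝒜 𝒜 i) : P t := by
  suffices h : ∀ t ∈ tensorGrading 𝒜 𝒜 i, P ((GradedTensorProduct.of k 𝒜 𝒜).symm t) from
    h _ ht
  intro t ht
  unfold tensorGrading at ht
  induction ht using Submodule.closure_induction with
  | zero => exact zero
  | add x y _ _ hx hy => exact add _ _ hx hy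
  | smul_mem r x hx =>
    obtain ⟨p, q, hpq, a, ha, b, hb, rfl⟩ := hx
    have := tmul p q hpq (r • a) (Submodule.smul_mem _ r ha) b hb
    rwa [← TensorProduct.smul_tmul'] at this

/-- A bilinear identity for products in `A ⊗^ε A` follows from the case of tensors with
homogeneous inner factors. -/
lemma gradedMul_ext {C : Type*} [AddCommGroup C] [Module k C] (Φ : A ⊗[k] A →ₗ[k] C)
    (Ψ : A ⊗[k] A →ₗ[k] A ⊗[k] A →ₗ[k] C)
    (heven : ∀ a b a' b' : A, (b ∈ 𝒜 0 ∧ ∃ i, a' ∈ 𝒜 i) ∨ ((∃ j, b ∈ 𝒜 j) ∧ a' ∈ 𝒜 0) →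
      Φ ((a * a') ⊗ₜ (b * b')) = Ψ (a ⊗ₜ b) (a' ⊗ₜ b'))
    (hodd : ∀ a b a' b' : A, b ∈ 𝒜 1 → a' ∈ 𝒜 1 →
      -Φ ((a * a') ⊗ₜ (b * b')) = Ψ (a ⊗ₜ b) (a' ⊗ₜ b')) (x y : A ⊗[k] A) :
    Φ ((GradedTensorProduct.of k 𝒜 𝒜).symm
      (GradedTensorProduct.of k 𝒜 𝒜 x * GradedTensorProduct.of k 𝒜 𝒜 y)) = Ψ x y := by
  induction x with
  | zero => simp
  | add u v hu hv => simp only [map_add, add_mul, LinearMap.add_apply, hu, hv]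
  | tmul a b =>
  induction y with
  | zero => simp
  | add u v hu hv => simp only [map_add, mul_add, hu, hv]
  | tmul a' b' =>
  induction b using homogeneous_induction (𝒜 := 𝒜) with
  | hadd u v hu hv =>
    simp only [TensorProduct.tmul_add, map_add, add_mul, LinearMap.add_apply, hu, hv]
  | h j b hb =>
  induction a' using homogeneous_induction (𝒜 := 𝒜) with
  | hadd u v hu hv => simp only [TensorProduct.add_tmul, map_add, mul_add, hu, hv]
  | h i a' ha' =>
  have h := GradedTensorProduct.tmul_coe_mul_coe_tmul (R := k) 𝒜 𝒜 a ⟨b, hb⟩ ⟨a', ha'⟩ b'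
  simp only at h
  rw [h]
  -- The sign is `(-1)^(j i)`, trivial unless both inner factors are odd.
  by_cases hji : j = 0 ∨ i = 0
  · have h0 : j * i = 0 := mul_eq_zero.2 hji
    rw [h0, uzpow_zero, one_smul]
    refine heven a b a' b' ?_
    rcases hji with rfl | rfl
    · exact Or.inl ⟨hb, i, ha'⟩
    · exact Or.inr ⟨⟨j, hb⟩, ha'⟩
  · have hj : j = 1 := by
      rcases not_or.1 hji with ⟨h1, _⟩
      revert h1; clear * -; revert j; decide
    have hi : i = 1 := by
      rcases not_or.1 hji with ⟨_, h1⟩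
      revert h1; clear * -; revert i; decide
    subst hj hi
    rw [mul_one, uzpow_one, ← hodd a b a' b' hb ha', Units.neg_smul, one_smul, map_neg, map_neg]
    rfl

variable [Coalgebra k A] [IsSuperAffineHopfAlgebra 𝒜]

lemma comul_mul_ext {C : Type*} [AddCommGroup C] [Module k C] (Φ : A ⊗[k] A →ₗ[k] C)
    (Ψ : A ⊗[k] A →ₗ[k] A ⊗[k] A →ₗ[k] C)
    (heven : ∀ a b a' b' : A, (b ∈ 𝒜 0 ∧ ∃ i, a' ∈ 𝒜 i) ∨ ((∃ j, b ∈ 𝒜 j) ∧ a' ∈ 𝒜 0) →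
      Φ ((a * a') ⊗ₜ (b * b')) = Ψ (a ⊗ₜ b) (a' ⊗ₜ b'))
    (hodd : ∀ a b a' b' : A, b ∈ 𝒜 1 → a' ∈ 𝒜 1 →
      -Φ ((a * a') ⊗ₜ (b * b')) = Ψ (a ⊗ₜ b) (a' ⊗ₜ b')) (a b : A) :
    Φ (Coalgebra.comul (a * b)) = Ψ (Coalgebra.comul a) (Coalgebra.comul b) := by
  rw [← gradedMul_ext 𝒜 Φ Ψ heven hodd, ← IsSuperAffineHopfAlgebra.comul_mul (𝒜 := 𝒜) a b]
  rfl

lemma comul_induction {i : ZMod 2} {a : A} (ha : a ∈ 𝒜 i) {P : A ⊗[k] A → Prop} (zero : P 0)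
    (tmul : ∀ p q, p + q = i → ∀ a ∈ 𝒜 p, ∀ b ∈ 𝒜 q, P (a ⊗ₜ b))
    (add : ∀ u v, P u → P v → P (u + v)) : P (Coalgebra.comul a) :=
  tensorGrading_induction 𝒜 zero tmul add (IsSuperAffineHopfAlgebra.comul_mem i a ha)

lemma piMap_odd {a : A} (ha : a ∈ 𝒜 1) : piMap 𝒜 a = 0 :=
  Ideal.Quotient.eq_zero_iff_mem.2 (Ideal.subset_span ha)

lemma piMap_eq_zero_iff {a : A} : piMap 𝒜 a = 0 ↔ a ∈ radFilt 𝒜 1 :=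
  Ideal.Quotient.eq_zero_iff_mem.trans (mem_superRadical 𝒜)

lemma piMap_surjective : Function.Surjective (piMap 𝒜) := Ideal.Quotient.mk_surjective

lemma Bquot_mul_comm (b c : Bquot 𝒜) : b * c = c * b := by
  obtain ⟨x, rfl⟩ := piMap_surjective 𝒜 b
  obtain ⟨y, rfl⟩ := piMap_surjective 𝒜 c
  rw [← proj_add_proj 𝒜 x, map_add, piMap_odd 𝒜 (proj_mem 𝒜 1 x), add_zero, ← map_mul, ← map_mul,
    even_mul_comm 𝒜 (proj_mem 𝒜 0 x)]

/-- The sign rule matters only when the inner factor `b` that is sent to `B` is odd, and then `π b =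
0`. So the ordinary tensor product is the right target. -/
lemma coaction_mul (a b : A) : coaction 𝒜 (a * b) = coaction 𝒜 a * coaction 𝒜 b := by
  let Φ := (piMap 𝒜).toLinearMap.lTensor A
  refine comul_mul_ext 𝒜 Φ ((LinearMap.mul k (A ⊗[k] Bquot 𝒜)).compl₁₂ Φ Φ) ?_ ?_ a b
  · intro a b a' b' _
    simp [Φ]
  · intro a b a' b' hb _
    simp [Φ, piMap_odd 𝒜 hb]

lemma coaction_one : coaction 𝒜 1 = 1 := by
  have h : Coalgebra.comul (R := k) (1 : A) = 1 ⊗ₜ 1 :=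
    IsSuperAffineHopfAlgebra.comul_one (𝒜 := 𝒜)
  simp [coaction, h, Algebra.TensorProduct.one_def]

/-- The coaction as a homomorphism of algebras. -/
def coactionHom : A →ₐ[k] A ⊗[k] Bquot 𝒜 :=
  AlgHom.ofLinearMap (coaction 𝒜) (coaction_one 𝒜) (coaction_mul 𝒜)

lemma coactionHom_apply (a : A) :
    coactionHom 𝒜 a = (piMap 𝒜).toLinearMap.lTensor A (Coalgebra.comul a) := rfl

/-- Descent of an algebra homomorphism killing the odd part. -/
def quotLift {C : Type*} [Ring C] [Algebra k C] (g : A →ₐ[k] C) (hg : ∀ a ∈ 𝒜 1, g a = 0) :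
    Bquot 𝒜 →ₐ[k] C :=
  Ideal.Quotient.liftₐ (superRadical 𝒜) g fun a ha => by
    have : superRadical 𝒜 ≤ RingHom.ker g := Ideal.span_le.2 fun a ha => hg a ha
    exact this ha

lemma quotLift_piMap {C : Type*} [Ring C] [Algebra k C] (g : A →ₐ[k] C)
    (hg : ∀ a ∈ 𝒜 1, g a = 0) (a : A) : quotLift 𝒜 g hg (piMap 𝒜 a) = g a := rfl

/-- The counit as a homomorphism of algebras. -/
def counitHom : A →ₐ[k] k :=
  AlgHom.ofLinearMap Coalgebra.counit (IsSuperAffineHopfAlgebra.counit_one 𝒜)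
    (IsSuperAffineHopfAlgebra.counit_mul 𝒜)

lemma counitHom_apply (a : A) : counitHom 𝒜 a = Coalgebra.counit (R := k) a := rfl

/-- The comultiplication of `B`, on `A`. -/
def comulToQuot : A →ₐ[k] Bquot 𝒜 ⊗[k] Bquot 𝒜 :=
  (Algebra.TensorProduct.map (piMap 𝒜) (AlgHom.id k (Bquot 𝒜))).comp (coactionHom 𝒜)

lemma comulToQuot_apply (a : A) : comulToQuot 𝒜 a =
    TensorProduct.map (piMap 𝒜).toLinearMap (piMap 𝒜).toLinearMap (Coalgebra.comul a) := by
  simp only [comulToQuot, AlgHom.comp_apply, coactionHom_apply]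
  induction Coalgebra.comul (R := k) a with
  | zero => simp
  | add x y hx hy => simp only [map_add, hx, hy]
  | tmul x y => simp

lemma comulToQuot_odd {a : A} (ha : a ∈ 𝒜 1) : comulToQuot 𝒜 a = 0 := by
  rw [comulToQuot_apply]
  refine comul_induction 𝒜 ha (P := fun t => TensorProduct.map (piMap 𝒜).toLinearMap
    (piMap 𝒜).toLinearMap t = 0) (map_zero _) ?_ ?_
  · intro p q hpq a ha b hb
    have hpq' : p = 1 ∨ q = 1 := by revert hpq; clear * -; revert p q; decide
    rcases hpq' with rfl | rfl
    · simp [piMap_odd 𝒜 ha]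
    · simp [piMap_odd 𝒜 hb]
  · intro u v hu hv
    rw [map_add, hu, hv, add_zero]

lemma coaction_coassoc (a : A) :
    TensorProduct.assoc k A (Bquot 𝒜) (Bquot 𝒜)
      ((coactionHom 𝒜).toLinearMap.rTensor (Bquot 𝒜) (coactionHom 𝒜 a)) =
    (quotLift 𝒜 (comulToQuot 𝒜) fun _ => comulToQuot_odd 𝒜).toLinearMap.lTensor A
      (coactionHom 𝒜 a) := by
  have h1 : ∀ t : A ⊗[k] A, TensorProduct.assoc k A (Bquot 𝒜) (Bquot 𝒜)
      ((coactionHom 𝒜).toLinearMap.rTensor (Bquot 𝒜) ((piMap 𝒜).toLinearMap.lTensor A t)) =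
      (TensorProduct.map (piMap 𝒜).toLinearMap (piMap 𝒜).toLinearMap).lTensor A
        (TensorProduct.assoc k A A A (Coalgebra.comul.rTensor A t)) := by
    intro t
    induction t with
    | zero => simp
    | add x y hx hy => simp only [map_add, hx, hy]
    | tmul x y =>
      simp only [LinearMap.lTensor_tmul, LinearMap.rTensor_tmul, AlgHom.toLinearMap_apply,
        coactionHom_apply]
      induction Coalgebra.comul (R := k) x with
      | zero => simp
      | add u v hu hv => simp only [map_add, TensorProduct.add_tmul, hu, hv]
      | tmul u v => simp
  have h2 : (quotLift 𝒜 (comulToQuot 𝒜) fun _ => comulToQuot_odd 𝒜).toLinearMap ∘ₗ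
      (piMap 𝒜).toLinearMap =
      TensorProduct.map (piMap 𝒜).toLinearMap (piMap 𝒜).toLinearMap ∘ₗ Coalgebra.comul := by
    ext a
    exact comulToQuot_apply 𝒜 a
  rw [coactionHom_apply, h1, Coalgebra.coassoc_apply, ← LinearMap.comp_apply,
    ← LinearMap.lTensor_comp, ← h2, LinearMap.lTensor_comp, LinearMap.comp_apply]

lemma coaction_mem (i : ZMod 2) {a : A} (ha : a ∈ 𝒜 i) :
    coactionHom 𝒜 a ∈ tensorTop (Bquot 𝒜) (𝒜 i) := by
  rw [coactionHom_apply]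
  refine comul_induction 𝒜 ha (P := fun t => (piMap 𝒜).toLinearMap.lTensor A t ∈
    tensorTop (Bquot 𝒜) (𝒜 i)) (by simp) ?_ ?_
  · intro p q hpq x hx y hy
    have hq : q = 0 ∨ q = 1 := by clear * -; revert q; decide
    rcases hq with rfl | rfl
    · rw [add_zero] at hpq
      subst hpq
      exact tmul_mem_tensorTop hx (piMap 𝒜 y)
    · simp [piMap_odd 𝒜 hy]
  · intro u v hu hv
    rw [map_add]; exact add_mem hu hv

/-- The Hopf algebra `B = A / J` with its coaction on `A`. -/
def evenQuotient : EvenQuotient 𝒜 (Bquot 𝒜) :=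
  have hS := IsSuperAffineHopfAlgebra.exists_antipode (𝒜 := 𝒜)
  { pi := piMap 𝒜
    coact := coactionHom 𝒜
    comul := quotLift 𝒜 (comulToQuot 𝒜) fun _ => comulToQuot_odd 𝒜
    counit := quotLift 𝒜 (counitHom 𝒜) IsSuperAffineHopfAlgebra.counit_odd
    antipode := quotLift 𝒜 ((piMap 𝒜).comp hS.choose) fun a ha =>
      piMap_odd 𝒜 (hS.choose_spec.1 1 a ha)
    mul_comm := Bquot_mul_comm 𝒜
    pi_surjective := piMap_surjective 𝒜
    ker_pi := by ext a; exact piMap_eq_zero_iff 𝒜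
    pi_coact := fun a => rfl
    coassoc := coaction_coassoc 𝒜
    counit_coact := fun a => by
      rw [coactionHom_apply, ← LinearMap.comp_apply, ← LinearMap.lTensor_comp]
      exact Coalgebra.lTensor_counit_comul a
    coact_mem := fun i a ha => coaction_mem 𝒜 i ha
    antipode_left := fun b => by
      obtain ⟨a, rfl⟩ := piMap_surjective 𝒜 b
      have h := congrArg (piMap 𝒜) (hS.choose_spec.2.1 a)
      rw [AlgHom.commutes] at h
      change _ = algebraMap k (Bquot 𝒜) (Coalgebra.counit a)
      rw [quotLift_piMap, comulToQuot_apply, ← h]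
      induction Coalgebra.comul (R := k) a with
      | zero => simp
      | add u v hu hv => simp only [map_add, hu, hv]
      | tmul u v => simp; rfl
    antipode_right := fun b => by
      obtain ⟨a, rfl⟩ := piMap_surjective 𝒜 b
      have h := congrArg (piMap 𝒜) (hS.choose_spec.2.2 a)
      rw [AlgHom.commutes] at h
      change _ = algebraMap k (Bquot 𝒜) (Coalgebra.counit a)
      rw [quotLift_piMap, comulToQuot_apply, ← h]
      induction Coalgebra.comul (R := k) a with
      | zero => simp
      | add u v hu hv => simp only [map_add, hu, hv]
      | tmul u v => simp; rfl }

lemma evenQuotient_counit (a : A) :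
    (evenQuotient 𝒜).counit (piMap 𝒜 a) = Coalgebra.counit (R := k) a := rfl

lemma mem_invariants {a : A} : a ∈ invariants 𝒜 ↔ coaction 𝒜 a = a ⊗ₜ 1 := Iff.rfl

end Construction

/-! ### Invariant superderivations and odd tangent vectors at the identity -/

section OddPointDerivations

variable {k : Type*} [Field k] {A : Type*} [Ring A] [Algebra k A]
  (𝒜 : ZMod 2 → Submodule k A) [GradedAlgebra 𝒜] [Coalgebra k A] [IsSuperAffineHopfAlgebra 𝒜]

/-- The odd derivations `A → k` at the counit. -/
def oddPointDer : Submodule k (A →ₗ[k] k) where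
  carrier := {δ | (∀ a ∈ 𝒜 0, δ a = 0) ∧ ∀ a b, δ (a * b) =
    δ a * Coalgebra.counit (R := k) b + Coalgebra.counit (R := k) a * δ b}
  add_mem' := by
    rintro δ η ⟨h1, h2⟩ ⟨h3, h4⟩
    refine ⟨fun a ha => by simp [h1 a ha, h3 a ha], fun a b => ?_⟩
    simp only [LinearMap.add_apply, h2, h4]
    ring
  zero_mem' := ⟨fun a _ => rfl, fun a b => by simp⟩
  smul_mem' := by
    rintro c δ ⟨h1, h2⟩
    refine ⟨fun a ha => by simp [h1 a ha], fun a b => ?_⟩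
    simp only [LinearMap.smul_apply, h2, smul_eq_mul]
    ring

lemma counit_odd {a : A} (ha : a ∈ 𝒜 1) : Coalgebra.counit (R := k) a = 0 :=
  IsSuperAffineHopfAlgebra.counit_odd a ha

lemma counit_parity (a : A) :
    Coalgebra.counit (R := k) (parity 𝒜 a) = Coalgebra.counit (R := k) a := by
  induction a using homogeneous_induction (𝒜 := 𝒜) with
  | hadd x y hx hy => simp only [map_add, hx, hy]
  | h i a ha =>
  fin_cases i
  · rw [parity_of_even 𝒜 ha]
  · rw [parity_of_odd 𝒜 ha, map_neg, counit_odd 𝒜 ha, neg_zero]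

lemma counit_radFilt {a : A} (ha : a ∈ radFilt 𝒜 1) : Coalgebra.counit (R := k) a = 0 := by
  rw [← evenQuotient_counit 𝒜, (piMap_eq_zero_iff 𝒜).2 ha, map_zero]

lemma oddPointDer_radFilt_two {δ : A →ₗ[k] k} (hδ : δ ∈ oddPointDer 𝒜) {a : A}
    (ha : a ∈ radFilt 𝒜 2) : δ a = 0 := by
  rw [← one_add_one_eq_two, ← radFilt_mul] at ha
  induction ha using Submodule.mul_induction_on' with
  | mem_mul_mem m hm n hn =>
    rw [hδ.2, counit_radFilt 𝒜 hm, counit_radFilt 𝒜 hn, mul_zero, zero_mul, add_zero]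
  | add x _ y _ hx hy => rw [map_add, hx, hy, add_zero]

/-- Lets an element be replaced by its odd part before a point derivation is evaluated. -/
lemma oddPointDer_proj {δ : A →ₗ[k] k} (hδ : δ ∈ oddPointDer 𝒜) (a : A) :
    δ (GradedAlgebra.proj 𝒜 1 a) = δ a := by
  conv_rhs => rw [← proj_add_proj 𝒜 a, map_add, hδ.1 _ (proj_mem 𝒜 0 a), zero_add]

instance oddPointDer_finite : Module.Finite k (oddPointDer 𝒜) := by
  obtain ⟨S, hS⟩ := (IsSuperAffineHopfAlgebra.finiteType (𝒜 := 𝒜)).out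
  let ev : oddPointDer 𝒜 →ₗ[k] (S → k) :=
    LinearMap.pi fun s => (LinearMap.applyₗ (s : A)) ∘ₗ (oddPointDer 𝒜).subtype
  refine Module.Finite.of_injective ev fun δ η hδ => ?_
  have h : ∀ s ∈ S, (δ : A →ₗ[k] k) s = (η : A →ₗ[k] k) s := fun s hs => congr_fun hδ ⟨s, hs⟩
  ext a
  have ha : a ∈ Algebra.adjoin k (S : Set A) := hS ▸ trivial
  induction ha using Algebra.adjoin_induction with
  | mem x hx => exact h x hx
  | algebraMap r =>
    rw [δ.2.1 _ (algebraMap_mem_even 𝒜 r), η.2.1 _ (algebraMap_mem_even 𝒜 r)]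
  | add x y _ _ hx hy => rw [map_add, hx, hy, map_add]
  | mul x y _ _ hx hy => rw [δ.2.2, η.2.2, hx, hy]

instance oddPointDer_free : Module.Free k (oddPointDer 𝒜) :=
  Module.Free.of_divisionRing k (oddPointDer 𝒜)

/-- The right-invariant operator `(δ ⊗ id) ∘ Δ`. -/
def rightInvOp (δ : A →ₗ[k] k) : A →ₗ[k] A :=
  (TensorProduct.lid k A).toLinearMap ∘ₗ δ.rTensor A ∘ₗ Coalgebra.comul

/-- The left-invariant operator `(parity ⊗ δ) ∘ Δ`. -/
def leftInvOp (δ : A →ₗ[k] k) : A →ₗ[k] A :=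
  (TensorProduct.rid k A).toLinearMap ∘ₗ TensorProduct.map (parity 𝒜) δ ∘ₗ Coalgebra.comul

lemma lid_counit_comul (a : A) :
    TensorProduct.lid k A ((Coalgebra.counit (R := k)).rTensor A (Coalgebra.comul a)) = a := by
  rw [Coalgebra.rTensor_counit_comul]; simp

lemma rid_counit_comul (a : A) :
    TensorProduct.rid k A ((Coalgebra.counit (R := k)).lTensor A (Coalgebra.comul a)) = a := by
  rw [Coalgebra.lTensor_counit_comul]; simp

lemma rightInvOp_counit (δ : A →ₗ[k] k) (a : A) :
    Coalgebra.counit (R := k) (rightInvOp δ a) = δ a := by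
  have h : ∀ t : A ⊗[k] A, Coalgebra.counit (R := k) (TensorProduct.lid k A (δ.rTensor A t)) =
      δ (TensorProduct.rid k A ((Coalgebra.counit (R := k)).lTensor A t)) := by
    intro t
    induction t with
    | zero => simp
    | add x y hx hy => simp only [map_add, hx, hy]
    | tmul x y => simp [mul_comm]
  exact (h _).trans (by rw [rid_counit_comul])

lemma leftInvOp_counit (δ : A →ₗ[k] k) (a : A) :
    Coalgebra.counit (R := k) (leftInvOp 𝒜 δ a) = δ a := by
  have h : ∀ t : A ⊗[k] A, Coalgebra.counit (R := k) (TensorProduct.rid k A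
      (TensorProduct.map (parity 𝒜) δ t)) =
      δ (TensorProduct.lid k A ((Coalgebra.counit (R := k)).rTensor A t)) := by
    intro t
    induction t with
    | zero => simp
    | add x y hx hy => simp only [map_add, hx, hy]
    | tmul x y => simp [mul_comm, counit_parity]
  exact (h _).trans (by rw [lid_counit_comul])

lemma comul_rightInvOp (δ : A →ₗ[k] k) :
    Coalgebra.comul ∘ₗ rightInvOp δ = (rightInvOp δ).rTensor A ∘ₗ Coalgebra.comul := by
  have h1 : ∀ t : A ⊗[k] A, Coalgebra.comul (TensorProduct.lid k A (δ.rTensor A t)) =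
      TensorProduct.lid k (A ⊗[k] A) (δ.rTensor (A ⊗[k] A) (Coalgebra.comul.lTensor A t)) := by
    intro t
    induction t with
    | zero => simp
    | add x y hx hy => simp only [map_add, hx, hy]
    | tmul x y => simp
  have h2 : ∀ t : A ⊗[k] A, (rightInvOp δ).rTensor A t =
      TensorProduct.lid k (A ⊗[k] A) (δ.rTensor (A ⊗[k] A)
        (TensorProduct.assoc k A A A (Coalgebra.comul.rTensor A t))) := by
    intro t
    induction t with
    | zero => simp
    | add x y hx hy => simp only [map_add, hx, hy]
    | tmul x y =>
      simp only [LinearMap.rTensor_tmul, rightInvOp, LinearMap.comp_apply, LinearEquiv.coe_coe]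
      induction Coalgebra.comul (R := k) x with
      | zero => simp
      | add u v hu hv => simp only [map_add, TensorProduct.add_tmul, hu, hv]
      | tmul u v => simp [TensorProduct.smul_tmul']
  ext a
  rw [LinearMap.comp_apply, LinearMap.comp_apply, h2, Coalgebra.coassoc_apply, ← h1]
  rfl

lemma comul_parity (a : A) : Coalgebra.comul (R := k) (parity 𝒜 a) =
    TensorProduct.map (parity 𝒜) (parity 𝒜) (Coalgebra.comul a) := by
  induction a using homogeneous_induction (𝒜 := 𝒜) with
  | hadd x y hx hy => simp only [map_add, hx, hy]
  | h i a ha =>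
  have hpq : ∀ p q : ZMod 2, p + q = i → (p = 0 ∧ q = i) ∨ (p = 1 ∧ q = i + 1) := by
    clear * -; revert i; decide
  fin_cases i
  · rw [parity_of_even 𝒜 ha]
    refine comul_induction 𝒜 ha (P := fun t => t = TensorProduct.map (parity 𝒜) (parity 𝒜) t)
      (by simp) ?_ (fun u v hu hv => by rw [map_add, ← hu, ← hv])
    intro p q h x hx y hy
    rcases hpq p q h with ⟨rfl, rfl⟩ | ⟨rfl, rfl⟩
    · rw [TensorProduct.map_tmul, parity_of_even 𝒜 hx, parity_of_even 𝒜 hy]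
    · rw [TensorProduct.map_tmul, parity_of_odd 𝒜 hx, parity_of_odd 𝒜 hy,
        TensorProduct.neg_tmul, TensorProduct.tmul_neg, neg_neg]
  · rw [parity_of_odd 𝒜 ha, map_neg]
    refine comul_induction 𝒜 ha (P := fun t => -t = TensorProduct.map (parity 𝒜) (parity 𝒜) t)
      (by simp) ?_ (fun u v hu hv => by rw [map_add, ← hu, ← hv, neg_add])
    intro p q h x hx y hy
    rcases hpq p q h with ⟨rfl, rfl⟩ | ⟨rfl, rfl⟩
    · rw [TensorProduct.map_tmul, parity_of_even 𝒜 hx, parity_of_odd 𝒜 hy,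
        TensorProduct.tmul_neg]
    · rw [TensorProduct.map_tmul, parity_of_odd 𝒜 hx, parity_of_even 𝒜 hy,
        TensorProduct.neg_tmul]

lemma comul_leftInvOp (δ : A →ₗ[k] k) : Coalgebra.comul ∘ₗ leftInvOp 𝒜 δ =
    TensorProduct.map (parity 𝒜) (leftInvOp 𝒜 δ) ∘ₗ Coalgebra.comul := by
  have h1 : ∀ t : A ⊗[k] A, Coalgebra.comul (TensorProduct.rid k A
      (TensorProduct.map (parity 𝒜) δ t)) = (TensorProduct.rid k A).toLinearMap.lTensor A
        (TensorProduct.map (parity 𝒜) (TensorProduct.map (parity 𝒜) δ)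
          (TensorProduct.assoc k A A A (Coalgebra.comul.rTensor A t))) := by
    intro t
    induction t with
    | zero => simp
    | add x y hx hy => simp only [map_add, hx, hy]
    | tmul x y =>
      simp only [LinearMap.rTensor_tmul, TensorProduct.map_tmul, TensorProduct.rid_tmul, map_smul,
        comul_parity]
      induction Coalgebra.comul (R := k) x with
      | zero => simp
      | add u v hu hv => simp only [map_add, TensorProduct.add_tmul, smul_add, hu, hv]
      | tmul u v => simp
  have h2 : ∀ t : A ⊗[k] A, TensorProduct.map (parity 𝒜) (leftInvOp 𝒜 δ) t =
      (TensorProduct.rid k A).toLinearMap.lTensor A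
        (TensorProduct.map (parity 𝒜) (TensorProduct.map (parity 𝒜) δ)
          (Coalgebra.comul.lTensor A t)) := by
    intro t
    induction t with
    | zero => simp
    | add x y hx hy => simp only [map_add, hx, hy]
    | tmul x y => simp [leftInvOp]
  ext a
  rw [LinearMap.comp_apply, LinearMap.comp_apply, h2, ← Coalgebra.coassoc_apply, ← h1]
  rfl

/-- The Leibniz rule is `δ(a a') = δ(a) ε(a') + ε(a) δ(a')` spread over the second tensor factors.
When `b` and `a'` are both odd, `ε(a') = 0` leaves only the second term, and `parity b = -b`
accounts for the sign. Otherwise either `b` is even or `δ(a') = 0`, so parity has no effect. -/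
lemma rightInvOp_mem {δ : A →ₗ[k] k} (hδ : δ ∈ oddPointDer 𝒜) : rightInvOp δ ∈ oddSuperDer 𝒜 := by
  refine ⟨fun i a ha => ?_, fun a b => ?_⟩
  · refine comul_induction 𝒜 ha
      (P := fun t => TensorProduct.lid k A (δ.rTensor A t) ∈ 𝒜 (i + 1)) (by simp) ?_
      (fun u v hu hv => by rw [map_add, map_add]; exact add_mem hu hv)
    intro p q hpq x hx y hy
    rw [LinearMap.rTensor_tmul, TensorProduct.lid_tmul]
    have hp : p = 0 ∨ q = i + 1 := by revert hpq; clear * -; revert p q i; decide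
    rcases hp with rfl | rfl
    · rw [hδ.1 x hx, zero_smul]; exact zero_mem _
    · exact Submodule.smul_mem _ _ hy
  · let Φ : A ⊗[k] A →ₗ[k] A := (TensorProduct.lid k A).toLinearMap ∘ₗ δ.rTensor A
    let E : A ⊗[k] A →ₗ[k] A :=
      (TensorProduct.lid k A).toLinearMap ∘ₗ (Coalgebra.counit (R := k)).rTensor A
    have h := comul_mul_ext 𝒜 Φ ((LinearMap.mul k A).compl₁₂ Φ E +
      (LinearMap.mul k A).compl₁₂ (parity 𝒜 ∘ₗ E) Φ) ?_ ?_ a b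
    · have hE : ∀ a, E (Coalgebra.comul a) = a := lid_counit_comul
      simp only [LinearMap.add_apply, LinearMap.compl₁₂_apply, LinearMap.mul_apply',
        LinearMap.comp_apply, hE] at h
      exact h
    · intro a b a' b' hh
      change δ (a * a') • (b * b') = (δ a • b) * (Coalgebra.counit (R := k) a' • b') +
        parity 𝒜 (Coalgebra.counit (R := k) a • b) * (δ a' • b')
      rw [hδ.2, map_smul, smul_mul_smul_comm, smul_mul_smul_comm, add_smul]
      congr 1
      rcases hh with ⟨hb, _⟩ | ⟨_, ha'⟩
      · rw [parity_of_even 𝒜 hb]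
      · rw [hδ.1 a' ha', mul_zero, zero_smul, zero_smul]
    · intro a b a' b' hb ha'
      change -(δ (a * a') • (b * b')) = (δ a • b) * (Coalgebra.counit (R := k) a' • b') +
        parity 𝒜 (Coalgebra.counit (R := k) a • b) * (δ a' • b')
      rw [hδ.2, map_smul, smul_mul_smul_comm, smul_mul_smul_comm, counit_odd 𝒜 ha', mul_zero,
        zero_smul, zero_add, zero_add, parity_of_odd 𝒜 hb, neg_mul, smul_neg]

lemma leftInvOp_mem {δ : A →ₗ[k] k} (hδ : δ ∈ oddPointDer 𝒜) :
    leftInvOp 𝒜 δ ∈ oddSuperDer 𝒜 := by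
  refine ⟨fun i a ha => ?_, fun a b => ?_⟩
  · refine comul_induction 𝒜 ha
      (P := fun t => TensorProduct.rid k A (TensorProduct.map (parity 𝒜) δ t) ∈ 𝒜 (i + 1))
      (by simp) ?_ (fun u v hu hv => by rw [map_add, map_add]; exact add_mem hu hv)
    intro p q hpq x hx y hy
    rw [TensorProduct.map_tmul, TensorProduct.rid_tmul]
    have hp : q = 0 ∨ p = i + 1 := by revert hpq; clear * -; revert p q i; decide
    rcases hp with rfl | rfl
    · rw [hδ.1 y hy, zero_smul]; exact zero_mem _
    · exact Submodule.smul_mem _ _ (parity_mem 𝒜 hx)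
  · let Φ : A ⊗[k] A →ₗ[k] A :=
      (TensorProduct.rid k A).toLinearMap ∘ₗ TensorProduct.map (parity 𝒜) δ
    let E : A ⊗[k] A →ₗ[k] A :=
      (TensorProduct.rid k A).toLinearMap ∘ₗ (Coalgebra.counit (R := k)).lTensor A
    have h := comul_mul_ext 𝒜 Φ ((LinearMap.mul k A).compl₁₂ Φ E +
      (LinearMap.mul k A).compl₁₂ (parity 𝒜 ∘ₗ E) Φ) ?_ ?_ a b
    · have hE : ∀ a, E (Coalgebra.comul a) = a := rid_counit_comul
      simp only [LinearMap.add_apply, LinearMap.compl₁₂_apply, LinearMap.mul_apply',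
        LinearMap.comp_apply, hE] at h
      exact h
    · intro a b a' b' hh
      change δ (b * b') • parity 𝒜 (a * a') =
        (δ b • parity 𝒜 a) * (Coalgebra.counit (R := k) b' • a') +
        parity 𝒜 (Coalgebra.counit (R := k) b • a) * (δ b' • parity 𝒜 a')
      rw [hδ.2, map_smul, smul_mul_smul_comm, smul_mul_smul_comm, add_smul, parity_mul]
      congr 1
      rcases hh with ⟨hb, _⟩ | ⟨_, ha'⟩
      · rw [hδ.1 b hb, zero_mul, zero_smul, zero_smul]
      · rw [parity_of_even 𝒜 ha']
    · intro a b a' b' hb ha'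
      change -(δ (b * b') • parity 𝒜 (a * a')) =
        (δ b • parity 𝒜 a) * (Coalgebra.counit (R := k) b' • a') +
        parity 𝒜 (Coalgebra.counit (R := k) b • a) * (δ b' • parity 𝒜 a')
      rw [hδ.2, map_smul, smul_mul_smul_comm, smul_mul_smul_comm, counit_odd 𝒜 hb, zero_mul,
        zero_smul, add_zero, add_zero, parity_mul, parity_of_odd 𝒜 ha', mul_neg, smul_neg, neg_neg]

/-- `ε` vanishes on odd elements, so the sign in the superderivation rule disappears at the
identity. -/
lemma counit_comp_mem {D : A →ₗ[k] A} (hD : D ∈ oddSuperDer 𝒜) :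
    Coalgebra.counit ∘ₗ D ∈ oddPointDer 𝒜 := by
  refine ⟨fun a ha => counit_odd 𝒜 (by simpa using hD.1 0 a ha), fun a b => ?_⟩
  simp only [LinearMap.comp_apply, hD.2, map_add, ← counitHom_apply 𝒜, map_mul]
  rw [counitHom_apply 𝒜 (parity 𝒜 a), counit_parity]
  rfl

/-- Applying `id ⊗ ε` to the left-invariance identity recovers `D` from `ε ∘ D`. -/
lemma leftInvOp_counit_comp {D : A →ₗ[k] A} (hD : D ∈ gMinus 𝒜) :
    leftInvOp 𝒜 (Coalgebra.counit ∘ₗ D) = D := by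
  have h : ∀ t : A ⊗[k] A, TensorProduct.rid k A
      (TensorProduct.map (parity 𝒜) (Coalgebra.counit ∘ₗ D) t) =
      TensorProduct.rid k A ((Coalgebra.counit (R := k)).lTensor A
        (TensorProduct.map (parity 𝒜) D t)) := by
    intro t
    induction t with
    | zero => simp
    | add x y hx hy => simp only [map_add, hx, hy]
    | tmul x y => simp
  ext a
  refine (h (Coalgebra.comul a)).trans ?_
  rw [← LinearMap.comp_apply (TensorProduct.map _ _), ← hD.2]
  exact rid_counit_comul (D a)

/-- Left-invariant odd superderivations are determined by their values at the counit. -/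
def gMinusEquiv : gMinus 𝒜 ≃ₗ[k] oddPointDer 𝒜 where
  toFun D := ⟨Coalgebra.counit ∘ₗ (D : A →ₗ[k] A), counit_comp_mem 𝒜 D.2.1⟩
  map_add' D E := by ext a; simp
  map_smul' c D := by ext a; simp
  invFun δ := ⟨leftInvOp 𝒜 δ, leftInvOp_mem 𝒜 δ.2, comul_leftInvOp 𝒜 δ⟩
  left_inv D := Subtype.ext (leftInvOp_counit_comp 𝒜 D.2)
  right_inv δ := by
    ext a
    exact leftInvOp_counit 𝒜 _ a

lemma isOddRightInvariant_rightInvOp {δ : A →ₗ[k] k} (hδ : δ ∈ oddPointDer 𝒜) :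
    IsOddRightInvariant 𝒜 (rightInvOp δ) :=
  ⟨rightInvOp_mem 𝒜 hδ, comul_rightInvOp δ⟩

end OddPointDerivations

/-! ### Duality between `(J/J²)^G` and `𝔤_-`; existence of admissible choices -/

section Existence

variable {k : Type*} [Field k] {A : Type*} [Ring A] [Algebra k A]
  (𝒜 : ZMod 2 → Submodule k A) [GradedAlgebra 𝒜] [Coalgebra k A] [IsSuperAffineHopfAlgebra 𝒜]

lemma coaction_proj (i : ZMod 2) (a : A) : coaction 𝒜 (GradedAlgebra.proj 𝒜 i a) =
    (GradedAlgebra.proj 𝒜 i).rTensor (Bquot 𝒜) (coaction 𝒜 a) := by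
  induction a using homogeneous_induction (𝒜 := 𝒜) with
  | hadd x y hx hy => simp only [map_add, hx, hy]
  | h j a ha =>
  have hu := coaction_mem 𝒜 j ha
  rw [show coactionHom 𝒜 a = coaction 𝒜 a from rfl] at hu
  by_cases hij : j = i
  · subst hij
    rw [proj_of_mem 𝒜 ha]
    generalize coaction 𝒜 a = u at hu
    induction hu using tensorTop_induction with
    | zero => simp
    | add x y _ _ hx hy => rw [map_add, ← hx, ← hy]
    | tmul a ha b => rw [LinearMap.rTensor_tmul, proj_of_mem 𝒜 ha]
  · rw [proj_of_mem_ne 𝒜 ha hij, map_zero]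
    generalize coaction 𝒜 a = u at hu
    induction hu using tensorTop_induction with
    | zero => simp
    | add x y _ _ hx hy => rw [map_add, ← hx, ← hy, add_zero]
    | tmul a ha b => rw [LinearMap.rTensor_tmul, proj_of_mem_ne 𝒜 ha hij, TensorProduct.zero_tmul]

lemma proj_mem_invariants (i : ZMod 2) {a : A} (ha : a ∈ invariants 𝒜) :
    GradedAlgebra.proj 𝒜 i a ∈ invariants 𝒜 := by
  rw [mem_invariants] at ha ⊢
  rw [coaction_proj, ha, LinearMap.rTensor_tmul]

lemma modSq_eq_zero_iff {a : A} : modSq 𝒜 a = 0 ↔ a ∈ radFilt 𝒜 2 :=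
  (Submodule.Quotient.mk_eq_zero _).trans (mem_superRadical_sq 𝒜)

lemma ker_modSq : LinearMap.ker (modSq 𝒜) = radFilt 𝒜 2 := by
  ext a; exact modSq_eq_zero_iff 𝒜

lemma modSq_surjective : Function.Surjective (modSq 𝒜) := fun x => by
  obtain ⟨a, rfl⟩ := Submodule.Quotient.mk_surjective _ x
  exact ⟨a, rfl⟩

lemma rTensor_modSq_eq_zero_iff {u : A ⊗[k] Bquot 𝒜} :
    (modSq 𝒜).rTensor (Bquot 𝒜) u = 0 ↔ u ∈ tensorTop (Bquot 𝒜) (radFilt 𝒜 2) := by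
  constructor
  · intro hu
    rw [← ker_modSq]
    exact mem_tensorTop_of_rTensor_eq_zero _ (modSq_surjective 𝒜) hu
  · intro hu
    induction hu using tensorTop_induction with
    | zero => simp
    | add x y _ _ hx hy => rw [map_add, hx, hy, add_zero]
    | tmul a ha b =>
      rw [LinearMap.rTensor_tmul, (modSq_eq_zero_iff 𝒜).2 ha, TensorProduct.zero_tmul]

/-- Membership in `(J/J²)^G` in terms of the filtration. -/
lemma modSq_mem_invariantsJModSq {a : A} (ha : a ∈ radFilt 𝒜 1)
    (h : coaction 𝒜 a - a ⊗ₜ 1 ∈ tensorTop (Bquot 𝒜) (radFilt 𝒜 2)) :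
    modSq 𝒜 a ∈ invariantsJModSq 𝒜 := by
  refine Submodule.mem_map_of_mem ⟨(mem_superRadical 𝒜).2 ha, ?_⟩
  rw [← rTensor_modSq_eq_zero_iff, map_sub, sub_eq_zero] at h
  exact h

lemma exists_of_mem_invariantsJModSq {x : A ⧸ (superRadical 𝒜 * superRadical 𝒜)}
    (hx : x ∈ invariantsJModSq 𝒜) : ∃ a ∈ radFilt 𝒜 1,
      coaction 𝒜 a - a ⊗ₜ 1 ∈ tensorTop (Bquot 𝒜) (radFilt 𝒜 2) ∧ modSq 𝒜 a = x := by
  obtain ⟨a, ⟨h1, h2⟩, rfl⟩ := hx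
  refine ⟨a, (mem_superRadical 𝒜).1 h1, ?_, rfl⟩
  rw [← rTensor_modSq_eq_zero_iff, map_sub, sub_eq_zero]
  exact h2

/-- The even part of a product `o b` with `o` odd is `o b₁`, a product of two odd elements; so
`J/J²` is purely odd. -/
lemma proj_even_mem_radFilt_two {a : A} (ha : a ∈ radFilt 𝒜 1) :
    GradedAlgebra.proj 𝒜 0 a ∈ radFilt 𝒜 2 := by
  rw [radFilt, pow_one] at ha
  induction ha using Submodule.mul_induction_on' with
  | add x _ y _ hx hy => rw [map_add]; exact add_mem hx hy
  | mem_mul_mem o ho b _ =>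
    rw [← proj_add_proj 𝒜 b, mul_add, map_add,
      proj_of_mem_ne 𝒜 (mul_mem_add 𝒜 ho (proj_mem 𝒜 0 b)) (by decide : (1 : ZMod 2) + 0 ≠ 0),
      zero_add, proj_of_mem 𝒜 (show _ ∈ 𝒜 0 from mul_mem_add 𝒜 ho (proj_mem 𝒜 1 b))]
    have := mul_mem_radFilt 𝒜 (odd_mem_radFilt 𝒜 ho) (odd_mem_radFilt 𝒜 (proj_mem 𝒜 1 b))
    rwa [one_add_one_eq_two] at this

/-- An odd element killed by all odd derivations at the counit is a combination of products of odd
elements and even elements of the augmentation ideal. -/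
lemma mem_odd_mul_of_oddPointDer {y : A} (hy : y ∈ 𝒜 1) (h : ∀ δ ∈ oddPointDer 𝒜, δ y = 0) :
    y ∈ 𝒜 1 * (𝒜 0 ⊓ LinearMap.ker (Coalgebra.counit (R := k) (A := A))) := by
  set K := 𝒜 1 * (𝒜 0 ⊓ LinearMap.ker (Coalgebra.counit (R := k) (A := A))) with hK
  have hodd : K ≤ 𝒜 1 := Submodule.mul_le.2 fun a ha b hb => by
    simpa using mul_mem_add 𝒜 ha hb.1
  by_contra hyK
  have hyN : y ∉ 𝒜 0 ⊔ K := by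
    intro hyN
    obtain ⟨e, he, w, hw, hew⟩ := Submodule.mem_sup.1 hyN
    have : e = 0 := disjoint_even_odd 𝒜 he (by
      rw [← eq_sub_iff_add_eq] at hew
      rw [hew]; exact sub_mem hy (hodd hw))
    rw [this, zero_add] at hew
    exact hyK (hew ▸ hw)
  -- A functional separating `y` from `A_+ + K` is itself an odd point derivation: vanishing on `a
  -- (b - ε(b))` is the Leibniz rule. This contradicts the hypothesis on `y`.
  obtain ⟨l, hl, hlN⟩ := Submodule.exists_dual_map_eq_bot_of_notMem hyN inferInstance
  have hl0 : ∀ a ∈ 𝒜 0 ⊔ K, l a = 0 := fun a ha => by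
    have := Submodule.mem_map_of_mem (f := l) ha
    rwa [hlN, Submodule.mem_bot] at this
  have hle : ∀ a ∈ 𝒜 0, l a = 0 := fun a ha => hl0 a (Submodule.mem_sup_left ha)
  have hlm : ∀ a ∈ 𝒜 1, ∀ b ∈ 𝒜 0, l (a * b) = l a * Coalgebra.counit (R := k) b := by
    intro a ha b hb
    have h1 : l (a * (b - algebraMap k A (Coalgebra.counit (R := k) b))) = 0 := by
      refine hl0 _ (Submodule.mem_sup_right (Submodule.mul_mem_mul ha
        ⟨sub_mem hb (algebraMap_mem_even 𝒜 _), ?_⟩))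
      change Coalgebra.counit (R := k) _ = 0
      rw [map_sub, ← counitHom_apply 𝒜, ← counitHom_apply 𝒜, AlgHom.commutes]
      simp
    rw [mul_sub, map_sub, sub_eq_zero] at h1
    rw [h1, ← Algebra.commutes, ← Algebra.smul_def, map_smul, smul_eq_mul, mul_comm]
  refine hl (h l ⟨hle, fun a b => ?_⟩)
  induction a using homogeneous_induction (𝒜 := 𝒜) with
  | hadd x y hx hy => simp only [add_mul, map_add, hx, hy]; ring
  | h i a ha =>
  induction b using homogeneous_induction (𝒜 := 𝒜) with
  | hadd x y hx hy => simp only [mul_add, map_add, hx, hy]; ring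
  | h j b hb =>
  have hab := mul_mem_add 𝒜 ha hb
  fin_cases i <;> fin_cases j
  · rw [hle _ hab, hle _ ha, hle _ hb, zero_mul, mul_zero, add_zero]
  · rw [even_mul_comm 𝒜 ha, hlm b hb a ha, hle _ ha, zero_mul, zero_add, mul_comm]
  · rw [hlm a ha b hb, hle _ hb, mul_zero, add_zero]
  · rw [hle _ (show a * b ∈ 𝒜 0 from hab), counit_odd 𝒜 ha, counit_odd 𝒜 hb, zero_mul, mul_zero,
      add_zero]

/-- Nondegeneracy on the side of `(J/J²)^G`. Modulo `J²`, `y` equals `r(y ⊗ 1)`; its even part is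
already in `J²`, and its odd part is a sum of products to which `retract_mul_mem` applies. -/
lemma mem_radFilt_two_of_oddPointDer {y : A} (hy : y ∈ radFilt 𝒜 1)
    (hinv : coaction 𝒜 y - y ⊗ₜ 1 ∈ tensorTop (Bquot 𝒜) (radFilt 𝒜 2))
    (h : ∀ δ ∈ oddPointDer 𝒜, δ y = 0) : y ∈ radFilt 𝒜 2 := by
  obtain ⟨ψ, hψ1, hψ⟩ := (evenQuotient 𝒜).exists_section
  have h1 := (evenQuotient 𝒜).retract_sub_mem hψ1 hinv
  have h0 := mem_odd_mul_of_oddPointDer 𝒜 (proj_mem 𝒜 1 y) fun δ hδ => by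
    rw [oddPointDer_proj 𝒜 hδ, h δ hδ]
  have h2 : (evenQuotient 𝒜).retract ψ (GradedAlgebra.proj 𝒜 1 y ⊗ₜ 1) ∈ radFilt 𝒜 2 := by
    generalize GradedAlgebra.proj 𝒜 1 y = z at h0
    induction h0 using Submodule.mul_induction_on' with
    | add x _ y _ hx hy => rw [TensorProduct.add_tmul, map_add]; exact add_mem hx hy
    | mem_mul_mem a ha b hb =>
      exact (evenQuotient 𝒜).retract_mul_mem hψ (odd_mem_radFilt 𝒜 ha) hb.2
  have h3 := (evenQuotient 𝒜).retract_mem ψ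
    (tmul_mem_tensorTop (proj_even_mem_radFilt_two 𝒜 hy) (1 : Bquot 𝒜))
  have h4 : (evenQuotient 𝒜).retract ψ (y ⊗ₜ 1) ∈ radFilt 𝒜 2 := by
    rw [← proj_add_proj 𝒜 y, TensorProduct.add_tmul, map_add]
    exact add_mem h3 h2
  simpa using add_mem h1 h4

/-- Nondegeneracy on the side of the derivations. Each `r(a ⊗ 1)` is congruent modulo `J²` to a true
invariant, so `δ` kills it. These elements generate `J` modulo `J²`, whence `δ` vanishes on `J`,
which contains the odd part. -/
lemma oddPointDer_eq_zero (hk : ringChar k ≠ 2) {δ : A →ₗ[k] k} (hδ : δ ∈ oddPointDer 𝒜)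
    (h : ∀ θ ∈ invariants 𝒜 ⊓ 𝒜 1, δ θ = 0) : δ = 0 := by
  obtain ⟨ψ, hψ1, hψ⟩ := (evenQuotient 𝒜).exists_section
  obtain ⟨N, hN⟩ := exists_radFilt_eq_bot 𝒜 hk (IsSuperAffineHopfAlgebra.finiteType 𝒜)
  have hV : ∀ a ∈ radFilt 𝒜 1, (evenQuotient 𝒜).retract ψ (a ⊗ₜ 1) ∈
      LinearMap.ker δ ⊓ radFilt 𝒜 1 := by
    intro a ha
    refine ⟨?_, (evenQuotient 𝒜).retract_mem ψ (tmul_mem_tensorTop ha _)⟩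
    obtain ⟨m, hm, hm'⟩ := (evenQuotient 𝒜).exists_invariant hN 2 _
      ((evenQuotient 𝒜).invariant_defect hψ ha)
    have h1 := oddPointDer_radFilt_two 𝒜 hδ hm
    rw [map_sub, ← oddPointDer_proj 𝒜 hδ m,
      h _ ⟨proj_mem_invariants 𝒜 1 hm', proj_mem 𝒜 1 m⟩, zero_sub, neg_eq_zero] at h1
    exact h1
  have hF : ∀ a ∈ radFilt 𝒜 1, δ a = 0 := by
    intro a ha
    obtain ⟨u, hu, v, hv, rfl⟩ := Submodule.mem_sup.1
      ((evenQuotient 𝒜).radFilt_one_le hψ1 hψ hV ha)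
    rw [map_add, oddPointDer_radFilt_two 𝒜 hδ hv, add_zero]
    clear ha
    induction hu using Submodule.mul_induction_on' with
    | add x _ y _ hx hy => rw [map_add, hx, hy, add_zero]
    | mem_mul_mem x hx b _ =>
      rw [hδ.2, counit_radFilt 𝒜 hx.2, zero_mul, add_zero, show δ x = 0 from hx.1, zero_mul]
  ext a
  rw [← oddPointDer_proj 𝒜 hδ, hF _ (odd_mem_radFilt 𝒜 (proj_mem 𝒜 1 a))]
  rfl

/-- Finitely many independent odd derivations at the counit are separated by odd invariants. -/
lemma map_pi_invariants_eq_top (hk : ringChar k ≠ 2) {s : ℕ} (δ : Fin s → A →ₗ[k] k)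
    (hδ : ∀ i, δ i ∈ oddPointDer 𝒜) (hli : LinearIndependent k δ) :
    (invariants 𝒜 ⊓ 𝒜 1).map (LinearMap.pi δ) = ⊤ := by
  by_contra hne
  obtain ⟨g, hg, hle⟩ := Submodule.exists_le_ker_of_lt_top _ (lt_top_iff_ne_top.2 hne)
  apply hg
  have hgΦ : ∀ a, g (LinearMap.pi δ a) = (∑ i, g (Pi.single i 1) • δ i) a := by
    intro a
    refine (g.pi_apply_eq_sum_univ (LinearMap.pi δ a)).trans ?_
    simp only [LinearMap.sum_apply, LinearMap.smul_apply]
    refine Finset.sum_congr rfl fun i _ => ?_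
    have : (fun j => if i = j then (1 : k) else 0) = Pi.single i 1 := by
      ext j; simp [Pi.single_apply, eq_comm]
    rw [this, smul_eq_mul, smul_eq_mul, mul_comm]
    rfl
  have h0 : (∑ i, g (Pi.single i 1) • δ i) = 0 := by
    refine oddPointDer_eq_zero 𝒜 hk
      (sum_mem fun i _ => Submodule.smul_mem _ _ (hδ i)) fun θ hθ => ?_
    rw [← hgΦ]
    exact hle (Submodule.mem_map_of_mem hθ)
  have h2 := Fintype.linearIndependent_iff.1 hli _ h0
  refine LinearMap.pi_ext' fun i => LinearMap.ext_ring ?_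
  simpa using h2 i

lemma exists_dual_invariants (hk : ringChar k ≠ 2) {s : ℕ}
    (hs : s = Module.finrank k (oddPointDer 𝒜)) :
    ∃ (δ : Fin s → A →ₗ[k] k) (θ : Fin s → A), (∀ i, δ i ∈ oddPointDer 𝒜) ∧
      oddPointDer 𝒜 ≤ Submodule.span k (Set.range δ) ∧ (∀ i, θ i ∈ invariants 𝒜) ∧
      (∀ i, θ i ∈ 𝒜 1) ∧ ∀ i j, δ i (θ j) = if i = j then 1 else 0 := by
  let b : Module.Basis (Fin s) k (oddPointDer 𝒜) := Module.finBasisOfFinrankEq k _ hs.symm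
  have hli : LinearIndependent k (fun i => (b i : A →ₗ[k] k)) :=
    b.linearIndependent.map_injOn (oddPointDer 𝒜).subtype Subtype.val_injective.injOn
  have hspan : oddPointDer 𝒜 ≤ Submodule.span k (Set.range fun i => (b i : A →ₗ[k] k)) := by
    intro η hη
    have h := congrArg (oddPointDer 𝒜).subtype (b.sum_repr ⟨η, hη⟩)
    rw [map_sum] at h
    rw [show η = (oddPointDer 𝒜).subtype ⟨η, hη⟩ from rfl, ← h]
    exact sum_mem fun i _ => Submodule.smul_mem _ _ (Submodule.subset_span ⟨i, rfl⟩)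
  have hδ : ∀ i, (b i : A →ₗ[k] k) ∈ oddPointDer 𝒜 := fun i => (b i).2
  have hex : ∀ j : Fin s, ∃ θ ∈ invariants 𝒜 ⊓ 𝒜 1,
      LinearMap.pi (fun i => (b i : A →ₗ[k] k)) θ = Pi.single j (1 : k) := fun j => by
    rw [← Submodule.mem_map, map_pi_invariants_eq_top 𝒜 hk _ hδ hli]
    trivial
  choose θ hθ hΦθ using hex
  refine ⟨fun i => b i, θ, hδ, hspan, fun i => (hθ i).1, fun i => (hθ i).2, fun i j => ?_⟩
  have h := congr_fun (hΦθ j) i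
  rwa [Pi.single_apply] at h

lemma isAdapted_of_dual {s : ℕ} {δ : Fin s → A →ₗ[k] k} {θ : Fin s → A}
    (hδ : ∀ i, δ i ∈ oddPointDer 𝒜) (hspan : oddPointDer 𝒜 ≤ Submodule.span k (Set.range δ))
    (hinv : ∀ i, θ i ∈ invariants 𝒜) (hodd : ∀ i, θ i ∈ 𝒜 1)
    (hdual : ∀ i j, δ i (θ j) = if i = j then 1 else 0) :
    IsAdapted 𝒜 θ (fun i => rightInvOp (δ i)) where
  odd := hodd
  invariant := hinv
  rightInvariant i := isOddRightInvariant_rightInvOp 𝒜 (hδ i)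
  dual i j := by rw [rightInvOp_counit, hdual]
  linearIndependent := by
    refine Fintype.linearIndependent_iff.2 fun c hc i => ?_
    -- Point derivations kill `J²`, so `δ i` reads off the coefficient `c i`.
    have h1 : ∑ j, c j • θ j ∈ radFilt 𝒜 2 := by
      rw [← modSq_eq_zero_iff, map_sum]
      simpa using hc
    have h2 := oddPointDer_radFilt_two 𝒜 (hδ i) h1
    simpa [hdual] using h2
  span_eq := by
    apply le_antisymm
    · rw [Submodule.span_le]
      rintro _ ⟨i, rfl⟩
      refine modSq_mem_invariantsJModSq 𝒜 (odd_mem_radFilt 𝒜 (hodd i)) ?_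
      rw [(mem_invariants 𝒜).1 (hinv i), sub_self]
      exact zero_mem _
    · intro x hx
      obtain ⟨a, ha, hainv, rfl⟩ := exists_of_mem_invariantsJModSq 𝒜 hx
      -- The difference is still invariant modulo `J²`, and every point derivation kills it by
      -- duality.
      have hy : a - ∑ j, δ j a • θ j ∈ radFilt 𝒜 2 := by
        refine mem_radFilt_two_of_oddPointDer 𝒜 (sub_mem ha (sum_mem fun j _ =>
          Submodule.smul_mem _ _ (odd_mem_radFilt 𝒜 (hodd j)))) ?_ ?_
        · have : coaction 𝒜 (∑ j, δ j a • θ j) = (∑ j, δ j a • θ j) ⊗ₜ 1 :=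
            (mem_invariants 𝒜).1 (sum_mem fun j _ => Submodule.smul_mem _ _ (hinv j))
          rw [map_sub, this, TensorProduct.sub_tmul, sub_sub_sub_cancel_right]
          exact hainv
        · intro η hη
          have hle : Submodule.span k (Set.range δ) ≤
              LinearMap.ker (LinearMap.applyₗ (R := k) (M₂ := k) (a - ∑ j, δ j a • θ j)) := by
            rw [Submodule.span_le]
            rintro _ ⟨i, rfl⟩
            simp [hdual]
          exact hle (hspan hη)
      rw [← modSq_eq_zero_iff, map_sub, sub_eq_zero, map_sum] at hy
      rw [hy]
      exact sum_mem fun j _ => by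
        rw [map_smul]
        exact Submodule.smul_mem _ _ (Submodule.subset_span ⟨j, rfl⟩)

/-- Adapted choices exist. -/
lemma exists_isAdapted (hk : ringChar k ≠ 2) {s : ℕ} (hs : s = Module.finrank k (gMinus 𝒜)) :
    ∃ (θ : Fin s → A) (D' : Fin s → A →ₗ[k] A), IsAdapted 𝒜 θ D' := by
  rw [(gMinusEquiv 𝒜).finrank_eq] at hs
  obtain ⟨δ, θ, hδ, hspan, hinv, hodd, hdual⟩ := exists_dual_invariants 𝒜 hk hs
  exact ⟨θ, _, isAdapted_of_dual 𝒜 hδ hspan hinv hodd hdual⟩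

end Existence

/-! ### The Euler operator on the filtration generated by the `θ i` -/

section Adapted

variable {k : Type*} [Field k] {A : Type*} [Ring A] [Algebra k A]
  {𝒜 : ZMod 2 → Submodule k A} [GradedAlgebra 𝒜] [Coalgebra k A] [IsSuperAffineHopfAlgebra 𝒜]

lemma lid_counit_coaction (b : A) :
    TensorProduct.lid k (Bquot 𝒜) ((Coalgebra.counit (R := k)).rTensor _ (coaction 𝒜 b)) =
      piMap 𝒜 b := by
  have h1 : ∀ t : A ⊗[k] A, TensorProduct.lid k (Bquot 𝒜) ((Coalgebra.counit (R := k)).rTensor _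
      ((piMap 𝒜).toLinearMap.lTensor A t)) =
      piMap 𝒜 (TensorProduct.lid k A ((Coalgebra.counit (R := k)).rTensor A t)) := by
    intro t
    induction t with
    | zero => simp
    | add x y hx hy => simp only [map_add, hx, hy]
    | tmul x y => simp
  exact (h1 (Coalgebra.comul b)).trans (by rw [lid_counit_comul])

/-- Applying `ε ⊗ id` to `ρ(a) = a ⊗ 1` shows that an invariant is constant modulo `J`. This is how
values at the identity control invariants everywhere. -/
lemma piMap_of_mem_invariants {a : A} (ha : a ∈ invariants 𝒜) :
    piMap 𝒜 a = algebraMap k (Bquot 𝒜) (Coalgebra.counit a) := by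
  rw [← lid_counit_coaction, (mem_invariants 𝒜).1 ha]
  simp [Algebra.algebraMap_eq_smul_one]

lemma sub_algebraMap_counit_mem {a : A} (ha : a ∈ invariants 𝒜) :
    a - algebraMap k A (Coalgebra.counit a) ∈ radFilt 𝒜 1 := by
  rw [← piMap_eq_zero_iff, map_sub, piMap_of_mem_invariants ha, AlgHom.commutes, sub_self]

lemma coaction_rightInvariant {D : A →ₗ[k] A} (hD : IsOddRightInvariant 𝒜 D) (a : A) :
    coaction 𝒜 (D a) = D.rTensor (Bquot 𝒜) (coaction 𝒜 a) := by
  have h := LinearMap.congr_fun hD.2 a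
  simp only [LinearMap.comp_apply] at h
  simp only [coaction, LinearMap.comp_apply, h]
  induction Coalgebra.comul (R := k) a with
  | zero => simp
  | add x y hx hy => simp only [map_add, hx, hy]
  | tmul x y => simp

lemma oddSuperDer_one {D : A →ₗ[k] A} (hD : D ∈ oddSuperDer 𝒜) : D 1 = 0 := by
  have h := hD.2 1 1
  rw [parity_of_even 𝒜 (one_mem_even 𝒜), mul_one, mul_one, one_mul] at h
  exact left_eq_add.1 h

lemma oddSuperDer_odd_mul {D : A →ₗ[k] A} (hD : D ∈ oddSuperDer 𝒜) {o : A} (ho : o ∈ 𝒜 1)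
    (b : A) : D (o * b) = D o * b - o * D b := by
  rw [hD.2, parity_of_odd 𝒜 ho, neg_mul, sub_eq_add_neg]

lemma oddSuperDer_radFilt {D : A →ₗ[k] A} (hD : D ∈ oddSuperDer 𝒜) (n : ℕ) {a : A}
    (ha : a ∈ radFilt 𝒜 (n + 1)) : D a ∈ radFilt 𝒜 n := by
  induction n generalizing a with
  | zero => rw [radFilt_zero]; trivial
  | succ n ih =>
    rw [radFilt_succ] at ha
    induction ha using Submodule.mul_induction_on' with
    | add x _ y _ hx hy => rw [map_add]; exact add_mem hx hy
    | mem_mul_mem o ho b hb =>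
      rw [oddSuperDer_odd_mul hD ho]
      refine sub_mem (mul_mem_radFilt_left 𝒜 _ hb) ?_
      rw [radFilt_succ]
      exact Submodule.mul_mem_mul ho (ih hb)

variable {s : ℕ} {θ : Fin s → A} {D' : Fin s → A →ₗ[k] A}

namespace IsAdapted

lemma linearCombination_odd (h : IsAdapted 𝒜 θ D') (v : Fin s → k) :
    Fintype.linearCombination k θ v ∈ 𝒜 1 := by
  rw [Fintype.linearCombination_apply]
  exact sum_mem fun i _ => Submodule.smul_mem _ _ (h.odd i)

lemma linearCombination_invariant (h : IsAdapted 𝒜 θ D') (v : Fin s → k) :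
    Fintype.linearCombination k θ v ∈ invariants 𝒜 := by
  rw [Fintype.linearCombination_apply]
  exact sum_mem fun i _ => Submodule.smul_mem _ _ (h.invariant i)

lemma range_le_odd (h : IsAdapted 𝒜 θ D') :
    LinearMap.range (Fintype.linearCombination k θ) ≤ 𝒜 1 := by
  rintro _ ⟨v, rfl⟩; exact h.linearCombination_odd v

/-- Nakayama for the nilpotent ideal `J`: the classes of the `θ i` span `(J/J²)^G`, which generates
`J` modulo `J²`. -/
lemma radFilt_one_le (h : IsAdapted 𝒜 θ D') (hk : ringChar k ≠ 2) :
    radFilt 𝒜 1 ≤ LinearMap.range (Fintype.linearCombination k θ) * ⊤ := by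
  set Θ := LinearMap.range (Fintype.linearCombination k θ) with hΘ
  obtain ⟨ψ, hψ1, hψ⟩ := (evenQuotient 𝒜).exists_section
  obtain ⟨N, hN⟩ := exists_radFilt_eq_bot 𝒜 hk (IsSuperAffineHopfAlgebra.finiteType 𝒜)
  have hV : ∀ a ∈ radFilt 𝒜 1, (evenQuotient 𝒜).retract ψ (a ⊗ₜ 1) ∈ Θ ⊔ radFilt 𝒜 2 := by
    intro a ha
    have h1 : modSq 𝒜 ((evenQuotient 𝒜).retract ψ (a ⊗ₜ 1)) ∈ invariantsJModSq 𝒜 :=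
      modSq_mem_invariantsJModSq 𝒜 ((evenQuotient 𝒜).retract_mem ψ (tmul_mem_tensorTop ha _))
        ((evenQuotient 𝒜).invariant_defect hψ ha)
    rw [← h.span_eq, Submodule.mem_span_range_iff_exists_fun] at h1
    obtain ⟨c, hc⟩ := h1
    have h2 : (evenQuotient 𝒜).retract ψ (a ⊗ₜ 1) - Fintype.linearCombination k θ c ∈
        radFilt 𝒜 2 := by
      rw [← modSq_eq_zero_iff, map_sub, ← hc, Fintype.linearCombination_apply, map_sum, sub_eq_zero]
      simp only [map_smul]
    rw [← sub_add_cancel ((evenQuotient 𝒜).retract ψ (a ⊗ₜ 1)) (Fintype.linearCombination k θ c)]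
    exact add_mem (Submodule.mem_sup_right h2) (Submodule.mem_sup_left ⟨c, rfl⟩)
  have hle : radFilt 𝒜 1 ≤ Θ * ⊤ ⊔ radFilt 𝒜 2 := by
    refine ((evenQuotient 𝒜).radFilt_one_le hψ1 hψ hV).trans (sup_le ?_ le_sup_right)
    rw [Submodule.sup_mul]
    refine sup_le_sup le_rfl ?_
    exact Submodule.mul_le.2 fun a ha b _ => mul_mem_radFilt_right 𝒜 b ha
  -- Multiplying `J ⊆ ΘA + J²` by `J^n` pushes the remainder one step further.
  have hind : ∀ n, radFilt 𝒜 1 ≤ Θ * ⊤ ⊔ radFilt 𝒜 (n + 1) := by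
    intro n
    induction n with
    | zero => exact le_sup_right
    | succ n ih =>
      refine ih.trans (sup_le le_sup_left ?_)
      rw [add_comm, ← radFilt_mul]
      refine (mul_le_mul_left hle _).trans ?_
      rw [Submodule.sup_mul, radFilt_mul, mul_assoc]
      refine sup_le_sup (mul_le_mul_right le_top _) (le_of_eq ?_)
      congr 1; omega
  refine (hind N).trans (sup_le le_rfl ?_)
  exact ((radFilt_anti 𝒜 (Nat.le_succ N)).trans hN.le).trans bot_le

lemma radFilt_eq (h : IsAdapted 𝒜 θ D') (hk : ringChar k ≠ 2) (n : ℕ) :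
    radFilt 𝒜 n = LinearMap.range (Fintype.linearCombination k θ) ^ n * ⊤ :=
  radFilt_eq_of_odd_le 𝒜 h.range_le_odd (h.radFilt_one_le hk) n

lemma radFilt_eq_bot (h : IsAdapted 𝒜 θ D') (hk : ringChar k ≠ 2) :
    radFilt 𝒜 (s + 1) = ⊥ := by
  rw [h.radFilt_eq hk, range_pow_eq_bot 𝒜 hk _ h.linearCombination_odd (by simp)]
  exact Submodule.bot_mul _

lemma radFilt_succ_eq (h : IsAdapted 𝒜 θ D') (hk : ringChar k ≠ 2) (n : ℕ) :
    radFilt 𝒜 (n + 1) = LinearMap.range (Fintype.linearCombination k θ) * radFilt 𝒜 n := by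
  rw [h.radFilt_eq hk, h.radFilt_eq hk n, pow_succ', mul_assoc]

lemma apply_mem_invariants (h : IsAdapted 𝒜 θ D') (i : Fin s) {a : A} (ha : a ∈ invariants 𝒜) :
    D' i a ∈ invariants 𝒜 := by
  rw [mem_invariants] at ha ⊢
  rw [coaction_rightInvariant (h.rightInvariant i), ha, LinearMap.rTensor_tmul]

/-- Right-invariant operators preserve `A^G`, so the value is an invariant and is known modulo `J`
from its counit, given by `h.dual`. -/
lemma apply_linearCombination (h : IsAdapted 𝒜 θ D') (i : Fin s) (v : Fin s → k) :
    D' i (Fintype.linearCombination k θ v) - algebraMap k A (v i) ∈ radFilt 𝒜 1 := by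
  have h1 := sub_algebraMap_counit_mem (h.apply_mem_invariants i (h.linearCombination_invariant v))
  convert h1 using 3
  rw [Fintype.linearCombination_apply]
  simp [h.dual]

lemma euler_apply (a : A) : eulerDerivation θ D' a = ∑ i, θ i * D' i a := by
  simp [eulerDerivation]

/-- The sign from the odd derivation `D' i` cancels the one from moving `θ i` past `a`. -/
lemma euler_mul (h : IsAdapted 𝒜 θ D') (a b : A) : eulerDerivation θ D' (a * b) =
    eulerDerivation θ D' a * b + a * eulerDerivation θ D' b := by
  simp only [euler_apply, Finset.sum_mul, Finset.mul_sum, ← Finset.sum_add_distrib]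
  refine Finset.sum_congr rfl fun i _ => ?_
  rw [(h.rightInvariant i).1.2, mul_add, ← mul_assoc, ← mul_assoc, ← mul_odd 𝒜 (h.odd i), mul_assoc a]

lemma euler_one (h : IsAdapted 𝒜 θ D') : eulerDerivation θ D' 1 = 0 := by
  simp [euler_apply, oddSuperDer_one (h.rightInvariant _).1]

lemma euler_mem (h : IsAdapted 𝒜 θ D') (a : A) : eulerDerivation θ D' a ∈ radFilt 𝒜 1 := by
  rw [euler_apply]
  exact sum_mem fun i _ => mul_mem_radFilt_right 𝒜 _ (odd_mem_radFilt 𝒜 (h.odd i))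

lemma euler_graded (h : IsAdapted 𝒜 θ D') {i : ZMod 2} {a : A} (ha : a ∈ 𝒜 i) :
    eulerDerivation θ D' a ∈ 𝒜 i := by
  rw [euler_apply]
  refine sum_mem fun j _ => ?_
  have := mul_mem_add 𝒜 (h.odd j) ((h.rightInvariant j).1.1 i a ha)
  rwa [add_comm, add_assoc, show (1 : ZMod 2) + 1 = 0 from rfl, add_zero] at this

lemma euler_linearCombination (h : IsAdapted 𝒜 θ D') (v : Fin s → k) :
    eulerDerivation θ D' (Fintype.linearCombination k θ v) - Fintype.linearCombination k θ v ∈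
      radFilt 𝒜 2 := by
  rw [euler_apply]
  nth_rewrite 2 [Fintype.linearCombination_apply]
  rw [← Finset.sum_sub_distrib]
  refine sum_mem fun i _ => ?_
  rw [Algebra.smul_def, Algebra.commutes, ← mul_sub, ← one_add_one_eq_two]
  exact mul_mem_radFilt 𝒜 (odd_mem_radFilt 𝒜 (h.odd i)) (h.apply_linearCombination i v)

/-- The Euler operator acts on the `n`-th graded piece of the filtration as `n`. -/
lemma euler_sub_smul_mem (h : IsAdapted 𝒜 θ D') (hk : ringChar k ≠ 2) (n : ℕ) {a : A}
    (ha : a ∈ radFilt 𝒜 n) : eulerDerivation θ D' a - (n : k) • a ∈ radFilt 𝒜 (n + 1) := by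
  induction n generalizing a with
  | zero => simpa using h.euler_mem a
  | succ n ih =>
    rw [h.radFilt_succ_eq hk] at ha
    induction ha using Submodule.mul_induction_on' with
    | add x _ y _ hx hy =>
      rw [map_add, smul_add]
      convert add_mem hx hy using 1; abel
    | mem_mul_mem o ho b hb =>
      obtain ⟨v, rfl⟩ := ho
      set o := Fintype.linearCombination k θ v
      have h1 := mul_mem_radFilt 𝒜 (h.euler_linearCombination v) hb
      have h2 := mul_mem_radFilt 𝒜 (odd_mem_radFilt 𝒜 (h.linearCombination_odd v)) (ih hb)
      rw [show n + 1 + 1 = 2 + n by omega]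
      rw [show 1 + (n + 1) = 2 + n by omega] at h2
      convert add_mem h1 h2 using 1
      rw [h.euler_mul, Nat.cast_succ, add_smul, one_smul, mul_sub, sub_mul, mul_smul_comm]
      abel

/-- If `a ∈ J^n` and `D a = 0`, then `n a ∈ J^(n+1)`. Starting at `n = 1` and dividing by `1, …, s`
reaches `J^(s+1) = 0`. -/
lemma eq_zero_of_euler (h : IsAdapted 𝒜 θ D') (hk : ringChar k ≠ 2)
    (hn : ∀ n, 0 < n → n ≤ s → (n : k) ≠ 0) {a : A} (ha : a ∈ radFilt 𝒜 1)
    (hD : eulerDerivation θ D' a = 0) : a = 0 := by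
  have key : ∀ n ≤ s, a ∈ radFilt 𝒜 (n + 1) := by
    intro n
    induction n with
    | zero => intro _; exact ha
    | succ n ih =>
      intro hns
      have h1 := h.euler_sub_smul_mem hk (n + 1) (ih (by omega))
      rw [hD, zero_sub, neg_mem_iff] at h1
      exact (Submodule.smul_mem_iff _ (hn (n + 1) (Nat.succ_pos n) hns)).1 h1
  have := key s le_rfl
  rwa [h.radFilt_eq_bot hk, Submodule.mem_bot] at this

lemma exists_euler_eq_zero (h : IsAdapted 𝒜 θ D') (hk : ringChar k ≠ 2)
    (hn : ∀ n, 0 < n → n ≤ s → (n : k) ≠ 0) (a : A) :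
    ∃ b, b - a ∈ radFilt 𝒜 1 ∧ eulerDerivation θ D' b = 0 := by
  have key : ∀ n ≤ s, ∃ b, b - a ∈ radFilt 𝒜 1 ∧ eulerDerivation θ D' b ∈ radFilt 𝒜 (n + 1) := by
    intro n
    induction n with
    | zero => intro _; exact ⟨a, by simp, h.euler_mem a⟩
    | succ n ih =>
      intro hns
      obtain ⟨b, hb, hb'⟩ := ih (by omega)
      -- `D` acts as `n + 1` on the leading term of `D b ∈ J^(n+1)`, so this correction cancels it.
      refine ⟨b - ((n + 1 : ℕ) : k)⁻¹ • eulerDerivation θ D' b, ?_, ?_⟩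
      · rw [sub_right_comm]
        exact sub_mem hb (Submodule.smul_mem _ _ (h.euler_mem b))
      · have h1 := Submodule.smul_mem _ (-((n + 1 : ℕ) : k)⁻¹)
          (h.euler_sub_smul_mem hk (n + 1) hb')
        convert h1 using 1
        rw [map_sub, map_smul, smul_sub, smul_smul, neg_mul,
          inv_mul_cancel₀ (hn (n + 1) (Nat.succ_pos n) hns), neg_smul, neg_smul, one_smul]
        abel
  obtain ⟨b, hb, hb'⟩ := key s le_rfl
  rw [h.radFilt_eq_bot hk, Submodule.mem_bot] at hb'
  exact ⟨b, hb, hb'⟩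

/-- The subalgebra `ker D`. -/
def kerEuler (h : IsAdapted 𝒜 θ D') : Subalgebra k A where
  carrier := {a | eulerDerivation θ D' a = 0}
  mul_mem' {a b} (ha : eulerDerivation θ D' a = 0) (hb : eulerDerivation θ D' b = 0) := by
    change eulerDerivation θ D' (a * b) = 0
    rw [h.euler_mul, ha, hb, zero_mul, mul_zero, add_zero]
  add_mem' {a b} (ha : eulerDerivation θ D' a = 0) (hb : eulerDerivation θ D' b = 0) := by
    change eulerDerivation θ D' (a + b) = 0
    rw [map_add, ha, hb, add_zero]
  algebraMap_mem' r := by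
    change eulerDerivation θ D' (algebraMap k A r) = 0
    rw [Algebra.algebraMap_eq_smul_one, map_smul, h.euler_one, smul_zero]

lemma mem_kerEuler (h : IsAdapted 𝒜 θ D') {a : A} :
    a ∈ h.kerEuler ↔ eulerDerivation θ D' a = 0 := Iff.rfl

/-- `D` preserves degrees, so the odd part of a kernel element lies in `ker D ∩ J = 0`. -/
lemma kerEuler_even (h : IsAdapted 𝒜 θ D') (hk : ringChar k ≠ 2)
    (hn : ∀ n, 0 < n → n ≤ s → (n : k) ≠ 0) {a : A} (ha : a ∈ h.kerEuler) : a ∈ 𝒜 0 := by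
  rw [mem_kerEuler, ← proj_add_proj 𝒜 a, map_add] at ha
  have h0 := h.euler_graded (proj_mem 𝒜 0 a)
  have h1 := h.euler_graded (proj_mem 𝒜 1 a)
  have h2 : eulerDerivation θ D' (GradedAlgebra.proj 𝒜 1 a) = 0 := by
    refine disjoint_even_odd 𝒜 ?_ h1
    rw [← neg_eq_iff_add_eq_zero] at ha
    rw [← ha]; exact neg_mem h0
  have h3 := h.eq_zero_of_euler hk hn (odd_mem_radFilt 𝒜 (proj_mem 𝒜 1 a)) h2
  rw [← proj_add_proj 𝒜 a, h3, add_zero]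
  exact proj_mem 𝒜 0 a

lemma bijective_kerEuler (h : IsAdapted 𝒜 θ D') (hk : ringChar k ≠ 2)
    (hn : ∀ n, 0 < n → n ≤ s → (n : k) ≠ 0) :
    Function.Bijective ((piMap 𝒜).comp h.kerEuler.val) := by
  constructor
  · rw [injective_iff_map_eq_zero]
    intro a ha
    exact Subtype.ext (h.eq_zero_of_euler hk hn ((piMap_eq_zero_iff 𝒜).1 ha) a.2)
  · intro b
    obtain ⟨a, rfl⟩ := piMap_surjective 𝒜 b
    obtain ⟨b, hb, hb'⟩ := h.exists_euler_eq_zero hk hn a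
    refine ⟨⟨b, hb'⟩, ?_⟩
    rw [← piMap_eq_zero_iff, map_sub, sub_eq_zero] at hb
    exact hb

end IsAdapted

end Adapted

/-! ### Filtration, partial derivatives and Euler operator of the superpolynomial ring -/

section Exterior

variable {k : Type*} [Field k] {s : ℕ}

/-- The filtration of the superpolynomial ring by the powers of its augmentation ideal. -/
def extFilt (k : Type*) [Field k] (s n : ℕ) : Submodule k (SuperPoly k s) :=
  LinearMap.range (ExteriorAlgebra.ι k (M := Fin s → k)) ^ n * ⊤

lemma extFilt_zero : extFilt k s 0 = ⊤ := by simp [extFilt]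

lemma extFilt_succ (n : ℕ) : extFilt k s (n + 1) =
    LinearMap.range (ExteriorAlgebra.ι k (M := Fin s → k)) * extFilt k s n := by
  rw [extFilt, pow_succ', mul_assoc, extFilt]

lemma extFilt_eq_bot : extFilt k s (s + 1) = ⊥ := by
  rw [extFilt, range_ι_pow_eq_bot (by simp)]
  exact Submodule.bot_mul _

lemma ι_mul_mem_extFilt (v : Fin s → k) {n : ℕ} {x : SuperPoly k s} (hx : x ∈ extFilt k s n) :
    ExteriorAlgebra.ι k v * x ∈ extFilt k s (n + 1) := by
  rw [extFilt_succ]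
  exact Submodule.mul_mem_mul (LinearMap.mem_range_self _ v) hx

lemma exists_sub_algebraMap_mem_extFilt (x : SuperPoly k s) :
    ∃ r : k, x - algebraMap k _ r ∈ extFilt k s 1 := by
  induction x using CliffordAlgebra.left_induction with
  | algebraMap r => exact ⟨r, by simp⟩
  | add x y hx hy =>
    obtain ⟨r, hr⟩ := hx
    obtain ⟨t, ht⟩ := hy
    refine ⟨r + t, ?_⟩
    rw [map_add, add_sub_add_comm]
    exact add_mem hr ht
  | ι_mul x m _ =>
    refine ⟨0, ?_⟩
    rw [map_zero, sub_zero]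
    exact ι_mul_mem_extFilt m (n := 0) (by rw [extFilt_zero]; trivial)

/-- The odd partial derivative with respect to the `i`-th variable. -/
def extDer (i : Fin s) : SuperPoly k s →ₗ[k] SuperPoly k s :=
  CliffordAlgebra.contractLeft (Q := (0 : QuadraticForm k (Fin s → k)))
    (LinearMap.proj i : (Fin s → k) →ₗ[k] k)

lemma extDer_ι_mul (i : Fin s) (v : Fin s → k) (x : SuperPoly k s) :
    extDer i (ExteriorAlgebra.ι k v * x) = v i • x - ExteriorAlgebra.ι k v * extDer i x :=
  CliffordAlgebra.contractLeft_ι_mul _ _ _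

/-- The Euler operator of the superpolynomial ring. -/
def extEuler (k : Type*) [Field k] (s : ℕ) : SuperPoly k s →ₗ[k] SuperPoly k s :=
  ∑ i, LinearMap.mulLeft k (superPolyVar k i) ∘ₗ extDer i

lemma extEuler_apply (x : SuperPoly k s) :
    extEuler k s x = ∑ i, superPolyVar k i * extDer i x := by
  simp [extEuler]

lemma extEuler_ι_mul (v : Fin s → k) (x : SuperPoly k s) :
    extEuler k s (ExteriorAlgebra.ι k v * x) =
      ExteriorAlgebra.ι k v * x + ExteriorAlgebra.ι k v * extEuler k s x := by
  have hv : ExteriorAlgebra.ι k v = ∑ i, v i • superPolyVar k i := by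
    conv_lhs => rw [pi_eq_sum_univ' v]
    rw [map_sum]
    refine Finset.sum_congr rfl fun i _ => ?_
    rw [map_smul, superPolyVar]
  simp only [extEuler_apply, extDer_ι_mul, mul_sub, Finset.sum_sub_distrib]
  rw [sub_eq_add_neg, ← Finset.sum_neg_distrib, Finset.mul_sum]
  congr 1
  · conv_rhs => rw [hv, Finset.sum_mul]
    exact Finset.sum_congr rfl fun i _ => by rw [mul_smul_comm, smul_mul_assoc]
  · refine Finset.sum_congr rfl fun i _ => ?_
    rw [← mul_assoc, ← mul_assoc, ← neg_mul]
    congr 1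
    -- Anticommuting `v` past the variable turns the minus sign of the odd Leibniz rule into a plus.
    exact neg_eq_of_add_eq_zero_right (ExteriorAlgebra.ι_add_mul_swap _ _)

lemma extEuler_sub_smul_mem (n : ℕ) {x : SuperPoly k s} (hx : x ∈ extFilt k s n) :
    extEuler k s x - (n : k) • x ∈ extFilt k s (n + 1) := by
  induction n generalizing x with
  | zero =>
    rw [Nat.cast_zero, zero_smul, sub_zero, extEuler_apply]
    exact sum_mem fun i _ => ι_mul_mem_extFilt _ (n := 0) (by rw [extFilt_zero]; trivial)
  | succ n ih =>
    rw [extFilt_succ] at hx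
    induction hx using Submodule.mul_induction_on' with
    | add x _ y _ hx hy =>
      rw [map_add, smul_add, add_sub_add_comm]
      exact add_mem hx hy
    | mem_mul_mem o ho b hb =>
      obtain ⟨v, rfl⟩ := ho
      have h2 := ι_mul_mem_extFilt v (ih hb)
      convert h2 using 1
      rw [extEuler_ι_mul, Nat.cast_succ, add_smul, one_smul, mul_sub, mul_smul_comm]
      abel

end Exterior

/-! ### The isomorphisms `k[θ] ≅ A^G` and `A^G ⊗ ker D ≅ A` -/

section Adapted

variable {k : Type*} [Field k] {A : Type*} [Ring A] [Algebra k A]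
  {𝒜 : ZMod 2 → Submodule k A} [GradedAlgebra 𝒜] [Coalgebra k A] [IsSuperAffineHopfAlgebra 𝒜]
  {s : ℕ} {θ : Fin s → A} {D' : Fin s → A →ₗ[k] A}

variable (𝒜) in
/-- The invariants form a subalgebra. -/
def invariantsSubalgebra : Subalgebra k A where
  carrier := invariants 𝒜
  mul_mem' {a b} (ha : a ∈ invariants 𝒜) (hb : b ∈ invariants 𝒜) := by
    change a * b ∈ invariants 𝒜
    rw [mem_invariants] at ha hb ⊢
    rw [coaction_mul, ha, hb, Algebra.TensorProduct.tmul_mul_tmul, mul_one]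
  add_mem' ha hb := (invariants 𝒜).add_mem ha hb
  algebraMap_mem' r := by
    change algebraMap k A r ∈ invariants 𝒜
    rw [Algebra.algebraMap_eq_smul_one]
    exact Submodule.smul_mem _ _ (coaction_one 𝒜)

namespace IsAdapted

/-- The homomorphism from the superpolynomial ring sending the variables to the `θ i`. -/
def polyHom (h : IsAdapted 𝒜 θ D') (hk : ringChar k ≠ 2) : SuperPoly k s →ₐ[k] A :=
  exteriorLift 𝒜 hk (Fintype.linearCombination k θ) h.linearCombination_odd

lemma polyHom_ι (h : IsAdapted 𝒜 θ D') (hk : ringChar k ≠ 2) (v : Fin s → k) :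
    h.polyHom hk (ExteriorAlgebra.ι k v) = Fintype.linearCombination k θ v :=
  exteriorLift_ι 𝒜 hk _ _ v

lemma polyHom_var (h : IsAdapted 𝒜 θ D') (hk : ringChar k ≠ 2) (i : Fin s) :
    h.polyHom hk (superPolyVar k i) = θ i := by
  rw [superPolyVar, polyHom_ι, Fintype.linearCombination_apply_single, one_smul]

lemma polyHom_mem_radFilt (h : IsAdapted 𝒜 θ D') (hk : ringChar k ≠ 2) (n : ℕ)
    {x : SuperPoly k s} (hx : x ∈ extFilt k s n) : h.polyHom hk x ∈ radFilt 𝒜 n := by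
  induction n generalizing x with
  | zero => rw [radFilt_zero]; trivial
  | succ n ih =>
    rw [extFilt_succ] at hx
    rw [radFilt_succ]
    induction hx using Submodule.mul_induction_on' with
    | add x _ y _ hx hy => rw [map_add]; exact add_mem hx hy
    | mem_mul_mem o ho b hb =>
      obtain ⟨v, rfl⟩ := ho
      rw [map_mul, polyHom_ι]
      exact Submodule.mul_mem_mul (h.linearCombination_odd v) (ih hb)

/-- `D' i` and the partial derivative each lower the filtration by one, but their difference does
not: on `θ v` it is an error in `J`, and the odd Leibniz rule propagates this. -/
lemma apply_polyHom_sub_mem (h : IsAdapted 𝒜 θ D') (hk : ringChar k ≠ 2) (i : Fin s) (n : ℕ)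
    {x : SuperPoly k s} (hx : x ∈ extFilt k s n) :
    D' i (h.polyHom hk x) - h.polyHom hk (extDer i x) ∈ radFilt 𝒜 n := by
  induction n generalizing x with
  | zero => rw [radFilt_zero]; trivial
  | succ n ih =>
    rw [extFilt_succ] at hx
    induction hx using Submodule.mul_induction_on' with
    | add x _ y _ hx hy =>
      simp only [map_add, add_sub_add_comm]
      exact add_mem hx hy
    | mem_mul_mem o ho b hb =>
      obtain ⟨v, rfl⟩ := ho
      rw [extDer_ι_mul, map_sub, map_smul, map_mul (h.polyHom hk), map_mul (h.polyHom hk), polyHom_ι,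
        oddSuperDer_odd_mul (h.rightInvariant i).1 (h.linearCombination_odd v)]
      have h1 := mul_mem_radFilt 𝒜 (h.apply_linearCombination i v) (h.polyHom_mem_radFilt hk n hb)
      have h2 := mul_mem_radFilt 𝒜 (odd_mem_radFilt 𝒜 (h.linearCombination_odd v)) (ih hb)
      rw [add_comm 1 n] at h1 h2
      convert sub_mem h1 h2 using 1
      rw [sub_mul, mul_sub, Algebra.smul_def]
      abel

/-- If the image of `x` lies in `J^(n+1)`, the images of its partial derivatives lie in `J^n`. By
induction `E x = ∑ θᵢ ∂ᵢ x` has order `n + 1`, while `E x ≡ n x` to that order, and `n` can be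
divided out. -/
lemma mem_extFilt_of_polyHom (h : IsAdapted 𝒜 θ D') (hk : ringChar k ≠ 2)
    (hn : ∀ n, 0 < n → n ≤ s → (n : k) ≠ 0) (n : ℕ) (hns : n ≤ s + 1) {x : SuperPoly k s}
    (hx : h.polyHom hk x ∈ radFilt 𝒜 n) : x ∈ extFilt k s n := by
  induction n generalizing x with
  | zero => rw [extFilt_zero]; trivial
  | succ n ih =>
    -- For `n = 0` there is nothing to divide by; the counit kills the constant term instead.
    rcases Nat.eq_zero_or_pos n with rfl | hpos
    · obtain ⟨r, hr⟩ := exists_sub_algebraMap_mem_extFilt x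
      have h1 := counit_radFilt 𝒜 (sub_mem hx (h.polyHom_mem_radFilt hk 1 hr))
      rw [← map_sub (h.polyHom hk), sub_sub_cancel, AlgHom.commutes, ← counitHom_apply 𝒜, AlgHom.commutes] at h1
      rw [show r = 0 from h1, map_zero, sub_zero] at hr
      exact hr
    · have hxn := ih (by omega) (radFilt_anti 𝒜 (Nat.le_succ n) hx)
      have hd : ∀ i, extDer i x ∈ extFilt k s n := fun i => by
        refine ih (by omega) ?_
        have h1 := sub_mem (oddSuperDer_radFilt (h.rightInvariant i).1 n hx)
          (h.apply_polyHom_sub_mem hk i n hxn)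
        rwa [sub_sub_cancel] at h1
      have hE : extEuler k s x ∈ extFilt k s (n + 1) := by
        rw [extEuler_apply]
        exact sum_mem fun i _ => ι_mul_mem_extFilt _ (hd i)
      have h2 := sub_mem hE (extEuler_sub_smul_mem n hxn)
      rw [sub_sub_cancel] at h2
      exact (Submodule.smul_mem_iff _ (hn n hpos (by omega))).1 h2

lemma polyHom_injective (h : IsAdapted 𝒜 θ D') (hk : ringChar k ≠ 2)
    (hn : ∀ n, 0 < n → n ≤ s → (n : k) ≠ 0) : Function.Injective (h.polyHom hk) := by
  rw [injective_iff_map_eq_zero]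
  intro x hx
  have h1 := h.mem_extFilt_of_polyHom hk hn (s + 1) le_rfl (x := x) (by rw [hx]; exact zero_mem _)
  rwa [extFilt_eq_bot, Submodule.mem_bot] at h1

lemma polyHom_mem_invariants (h : IsAdapted 𝒜 θ D') (hk : ringChar k ≠ 2) (x : SuperPoly k s) :
    h.polyHom hk x ∈ invariantsSubalgebra 𝒜 := by
  induction x using CliffordAlgebra.left_induction with
  | algebraMap r => rw [AlgHom.commutes]; exact Subalgebra.algebraMap_mem _ r
  | add x y hx hy => rw [map_add]; exact add_mem hx hy
  | ι_mul x m hx =>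
    rw [map_mul]
    refine mul_mem ?_ hx
    rw [show h.polyHom hk (CliffordAlgebra.ι _ m) = _ from h.polyHom_ι hk m]
    exact h.linearCombination_invariant m

lemma range_polyHom_mul_kerEuler (h : IsAdapted 𝒜 θ D') (hk : ringChar k ≠ 2)
    (hn : ∀ n, 0 < n → n ≤ s → (n : k) ≠ 0) :
    LinearMap.range (h.polyHom hk).toLinearMap * Subalgebra.toSubmodule h.kerEuler = ⊤ := by
  set R := LinearMap.range (h.polyHom hk).toLinearMap * Subalgebra.toSubmodule h.kerEuler with hR
  have hΘ : LinearMap.range (Fintype.linearCombination k θ) =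
      (LinearMap.range (ExteriorAlgebra.ι k (M := Fin s → k))).map (h.polyHom hk).toLinearMap := by
    rw [← LinearMap.range_comp]
    congr 1
    ext v
    simp only [LinearMap.comp_apply, AlgHom.toLinearMap_apply, polyHom_ι]
  have htop : (⊤ : Submodule k A) ≤ Subalgebra.toSubmodule h.kerEuler ⊔ radFilt 𝒜 1 := by
    intro a _
    obtain ⟨b, hb, hb'⟩ := h.exists_euler_eq_zero hk hn a
    rw [← sub_sub_cancel b a]
    exact sub_mem (Submodule.mem_sup_left hb') (Submodule.mem_sup_right hb)
  -- `J^n = Θ^n A` and `A = ker D + J`: the first summand contributes to `R`, the second to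
  -- `J^(n+1)`.
  have hstep : ∀ n, radFilt 𝒜 n ≤ R ⊔ radFilt 𝒜 (n + 1) := by
    intro n
    have hpow : LinearMap.range (Fintype.linearCombination k θ) ^ n ≤ radFilt 𝒜 n := by
      rw [h.radFilt_eq hk]
      intro x hx
      simpa using Submodule.mul_mem_mul hx (show (1 : A) ∈ (⊤ : Submodule k A) from trivial)
    conv_lhs => rw [h.radFilt_eq hk]
    refine (mul_le_mul_right htop _).trans ?_
    rw [Submodule.mul_sup]
    refine sup_le_sup (mul_le_mul_left ?_ _) ?_
    · rw [hΘ, ← Submodule.map_pow]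
      exact LinearMap.map_le_range
    · rw [← radFilt_mul]
      exact mul_le_mul_left hpow _
  have hind : ∀ n, (⊤ : Submodule k A) ≤ R ⊔ radFilt 𝒜 n := by
    intro n
    induction n with
    | zero => rw [radFilt_zero]; exact le_sup_right
    | succ n ih => exact ih.trans (sup_le le_sup_left (hstep n))
  have := hind (s + 1)
  rw [h.radFilt_eq_bot hk, sup_bot_eq] at this
  exact top_le_iff.1 this

lemma coaction_euler (h : IsAdapted 𝒜 θ D') (a : A) : coaction 𝒜 (eulerDerivation θ D' a) =
    (eulerDerivation θ D').rTensor (Bquot 𝒜) (coaction 𝒜 a) := by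
  rw [euler_apply, map_sum]
  have h1 : ∀ i, coaction 𝒜 (θ i * D' i a) =
      (LinearMap.mulLeft k (θ i) ∘ₗ D' i).rTensor (Bquot 𝒜) (coaction 𝒜 a) := by
    intro i
    rw [coaction_mul, (mem_invariants 𝒜).1 (h.invariant i),
      coaction_rightInvariant (h.rightInvariant i)]
    induction coaction 𝒜 a with
    | zero => simp
    | add x y hx hy => simp only [map_add, mul_add, hx, hy]
    | tmul x y => simp
  simp only [h1]
  rw [← LinearMap.sum_apply]
  congr 1
  exact (map_sum (LinearMap.rTensorHom (R := k) (Bquot 𝒜))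
    (fun i => LinearMap.mulLeft k (θ i) ∘ₗ D' i) Finset.univ).symm

/-- `D` is colinear, and tensoring with the flat module `B` preserves its kernel, so `ker D` is a
subcomodule. -/
lemma coaction_kerEuler_mem (h : IsAdapted 𝒜 θ D') {b : A} (hb : b ∈ h.kerEuler) :
    coaction 𝒜 b ∈ tensorTop (Bquot 𝒜) (Subalgebra.toSubmodule h.kerEuler) := by
  have h1 := h.coaction_euler b
  rw [h.mem_kerEuler.1 hb, map_zero] at h1
  have hex : Function.Exact (Subalgebra.toSubmodule h.kerEuler).subtype (eulerDerivation θ D') :=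
    LinearMap.exact_subtype_ker_map (eulerDerivation θ D')
  obtain ⟨t, ht⟩ := (Module.Flat.rTensor_exact (Bquot 𝒜) hex _).1 h1.symm
  rw [← ht]
  clear ht
  induction t with
  | zero => simp
  | add x y hx hy => rw [map_add]; exact add_mem hx hy
  | tmul a b => exact tmul_mem_tensorTop a.2 b

/-- The algebra homomorphism `B ≅ ker D ⊆ A`. -/
def splitting (h : IsAdapted 𝒜 θ D') (hk : ringChar k ≠ 2)
    (hn : ∀ n, 0 < n → n ≤ s → (n : k) ≠ 0) : Bquot 𝒜 →ₐ[k] A :=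
  h.kerEuler.val.comp (AlgEquiv.ofBijective _ (h.bijective_kerEuler hk hn)).symm.toAlgHom

lemma splitting_piMap (h : IsAdapted 𝒜 θ D') (hk : ringChar k ≠ 2)
    (hn : ∀ n, 0 < n → n ≤ s → (n : k) ≠ 0) {b : A} (hb : b ∈ h.kerEuler) :
    h.splitting hk hn (piMap 𝒜 b) = b :=
  congrArg Subtype.val
    ((AlgEquiv.ofBijective _ (h.bijective_kerEuler hk hn)).symm_apply_apply ⟨b, hb⟩)

/-- `a ↦ a₀ φ(S a₁)`, where `φ` is the splitting of the projection. -/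
def coinvProj (h : IsAdapted 𝒜 θ D') (hk : ringChar k ≠ 2)
    (hn : ∀ n, 0 < n → n ≤ s → (n : k) ≠ 0) : A →ₗ[k] A :=
  LinearMap.mul' k A ∘ₗ ((h.splitting hk hn).comp (evenQuotient 𝒜).antipode).toLinearMap.lTensor A
    ∘ₗ coaction 𝒜

/-- As `b₀ ∈ ker D`, one has `b₀ = φ(π b₀)`, so `b₀ φ(S b₁) = φ(π(b₀) S(b₁))` collapses by the
antipode axiom. -/
lemma coinvProj_of_mem_kerEuler (h : IsAdapted 𝒜 θ D') (hk : ringChar k ≠ 2)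
    (hn : ∀ n, 0 < n → n ≤ s → (n : k) ≠ 0) {b : A} (hb : b ∈ h.kerEuler) :
    h.coinvProj hk hn b = algebraMap k A (Coalgebra.counit b) := by
  have key : ∀ u ∈ tensorTop (Bquot 𝒜) (Subalgebra.toSubmodule h.kerEuler),
      LinearMap.mul' k A
        (((h.splitting hk hn).comp (evenQuotient 𝒜).antipode).toLinearMap.lTensor A u) =
      h.splitting hk hn (LinearMap.mul' k (Bquot 𝒜)
        ((evenQuotient 𝒜).antipode.toLinearMap.lTensor _
          ((piMap 𝒜).toLinearMap.rTensor (Bquot 𝒜) u))) := by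
    intro u hu
    induction hu using tensorTop_induction with
    | zero => simp
    | add x y _ _ hx hy => simp only [map_add, hx, hy]
    | tmul a ha b => simp [h.splitting_piMap hk hn ha]
  refine (key _ (h.coaction_kerEuler_mem hb)).trans ?_
  have h1 : (piMap 𝒜).toLinearMap.rTensor (Bquot 𝒜) (coaction 𝒜 b) =
      (evenQuotient 𝒜).comul (piMap 𝒜 b) := (evenQuotient 𝒜).pi_coact b
  rw [h1, (evenQuotient 𝒜).antipode_right, AlgHom.commutes, evenQuotient_counit]

lemma coinvProj_mul (h : IsAdapted 𝒜 θ D') (hk : ringChar k ≠ 2)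
    (hn : ∀ n, 0 < n → n ≤ s → (n : k) ≠ 0) {x : A} (hx : x ∈ invariants 𝒜) (b : A) :
    h.coinvProj hk hn (x * b) = x * h.coinvProj hk hn b := by
  simp only [coinvProj, LinearMap.comp_apply, coaction_mul, (mem_invariants 𝒜).1 hx]
  induction coaction 𝒜 b with
  | zero => simp
  | add u v hu hv => simp only [map_add, mul_add, hu, hv]
  | tmul u v => simp [mul_assoc]

lemma coinvProj_invariant (h : IsAdapted 𝒜 θ D') (hk : ringChar k ≠ 2)
    (hn : ∀ n, 0 < n → n ≤ s → (n : k) ≠ 0) {x : A} (hx : x ∈ invariants 𝒜) :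
    h.coinvProj hk hn x = x := by
  simp [coinvProj, (mem_invariants 𝒜).1 hx]

/-- Multiplication `A^G ⊗ ker D → A` has a left inverse. -/
lemma map_coinvProj_coaction_mul (h : IsAdapted 𝒜 θ D') (hk : ringChar k ≠ 2)
    (hn : ∀ n, 0 < n → n ≤ s → (n : k) ≠ 0) {x b : A} (hx : x ∈ invariants 𝒜)
    (hb : b ∈ h.kerEuler) :
    TensorProduct.map (h.coinvProj hk hn) (h.splitting hk hn).toLinearMap (coaction 𝒜 (x * b)) =
      x ⊗ₜ b := by
  -- Here `x b₀ ⊗ b₁` goes to `x ε(b₀) ⊗ φ(b₁)`, and the counit axiom returns `x ⊗ φ(π b) = x ⊗ b`.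
  have key : ∀ u ∈ tensorTop (Bquot 𝒜) (Subalgebra.toSubmodule h.kerEuler),
      TensorProduct.map (h.coinvProj hk hn) (h.splitting hk hn).toLinearMap ((x ⊗ₜ 1) * u) =
      x ⊗ₜ h.splitting hk hn (TensorProduct.lid k (Bquot 𝒜)
        ((Coalgebra.counit (R := k)).rTensor _ u)) := by
    intro u hu
    induction hu using tensorTop_induction with
    | zero => simp
    | add x y _ _ hx hy => simp only [map_add, mul_add, TensorProduct.tmul_add, hx, hy]
    | tmul a ha b =>
      rw [Algebra.TensorProduct.tmul_mul_tmul, one_mul, TensorProduct.map_tmul,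
        h.coinvProj_mul hk hn hx, h.coinvProj_of_mem_kerEuler hk hn ha, ← Algebra.commutes,
        ← Algebra.smul_def]
      simp [TensorProduct.smul_tmul']
  rw [coaction_mul, (mem_invariants 𝒜).1 hx, key _ (h.coaction_kerEuler_mem hb),
    lid_counit_coaction, h.splitting_piMap hk hn hb]

/-- `coinvProj` sends `f(x) b` to `ε(b) f(x)`, with `f` the map `polyHom`. It therefore maps all of
`A = k[θ] B̃` into `k[θ]`, while fixing the invariants. -/
lemma range_polyHom (h : IsAdapted 𝒜 θ D') (hk : ringChar k ≠ 2)
    (hn : ∀ n, 0 < n → n ≤ s → (n : k) ≠ 0) {a : A} (ha : a ∈ invariants 𝒜) :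
    ∃ x, h.polyHom hk x = a := by
  have key : ∀ a ∈ LinearMap.range (h.polyHom hk).toLinearMap *
      Subalgebra.toSubmodule h.kerEuler,
      h.coinvProj hk hn a ∈ LinearMap.range (h.polyHom hk).toLinearMap := by
    intro a ha
    induction ha using Submodule.mul_induction_on' with
    | add x _ y _ hx hy => rw [map_add]; exact add_mem hx hy
    | mem_mul_mem y hy b hb =>
      obtain ⟨x, rfl⟩ := hy
      rw [AlgHom.toLinearMap_apply, h.coinvProj_mul hk hn (h.polyHom_mem_invariants hk x),
        h.coinvProj_of_mem_kerEuler hk hn hb, ← Algebra.commutes, ← Algebra.smul_def]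
      exact Submodule.smul_mem _ _ (LinearMap.mem_range_self _ x)
  have h1 := key a (by rw [h.range_polyHom_mul_kerEuler hk hn]; trivial)
  rwa [h.coinvProj_invariant hk hn ha] at h1

/-- Multiplication `A^G ⊗ ker D → A` is bijective. -/
lemma bijective_mul (h : IsAdapted 𝒜 θ D') (hk : ringChar k ≠ 2)
    (hn : ∀ n, 0 < n → n ≤ s → (n : k) ≠ 0) :
    Function.Bijective (LinearMap.mul' k A ∘ₗ
      TensorProduct.map (invariantsSubalgebra 𝒜).val.toLinearMap h.kerEuler.val.toLinearMap) := by
  constructor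
  · have hinj : Function.Injective (TensorProduct.map (invariantsSubalgebra 𝒜).val.toLinearMap
        h.kerEuler.val.toLinearMap) :=
      TensorProduct.map_injective_of_flat_flat _ _ Subtype.val_injective Subtype.val_injective
    have hcomp : TensorProduct.map (h.coinvProj hk hn) (h.splitting hk hn).toLinearMap ∘ₗ
        coaction 𝒜 ∘ₗ LinearMap.mul' k A ∘ₗ TensorProduct.map
          (invariantsSubalgebra 𝒜).val.toLinearMap h.kerEuler.val.toLinearMap =
        TensorProduct.map (invariantsSubalgebra 𝒜).val.toLinearMap
          h.kerEuler.val.toLinearMap := by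
      refine TensorProduct.ext' fun x b => ?_
      exact h.map_coinvProj_coaction_mul hk hn x.2 b.2
    rw [← hcomp] at hinj
    exact Function.Injective.of_comp (f := TensorProduct.map (h.coinvProj hk hn)
      (h.splitting hk hn).toLinearMap ∘ₗ coaction 𝒜) hinj
  · rw [← LinearMap.range_eq_top, ← top_le_iff, ← h.range_polyHom_mul_kerEuler hk hn,
      Submodule.mul_le]
    rintro _ ⟨x, rfl⟩ b hb
    exact ⟨⟨_, h.polyHom_mem_invariants hk x⟩ ⊗ₜ ⟨b, hb⟩, rfl⟩

end IsAdapted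

end Adapted

/-! ### Induced gradings and isomorphisms of superalgebras -/

section Gradings

variable {k : Type*} [Field k] {A B C : Type*} [Ring A] [Algebra k A] [Ring B] [Algebra k B]
  [Ring C] [Algebra k C]

/-- The homogeneous components of the elements of a subalgebra stable under the projections. -/
def inducedProj (𝒜 : ZMod 2 → Submodule k A) [GradedAlgebra 𝒜] (S : Subalgebra k A)
    (hS : ∀ i, ∀ a ∈ S, GradedAlgebra.proj 𝒜 i a ∈ S) (i : ZMod 2) :
    S →ₗ[k] inducedGrading 𝒜 S i where
  toFun a := ⟨⟨GradedAlgebra.proj 𝒜 i a, hS i a a.2⟩, proj_mem 𝒜 i (a : A)⟩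
  map_add' a b := Subtype.ext <| Subtype.ext <| map_add (GradedAlgebra.proj 𝒜 i) (a : A) b
  map_smul' c a := Subtype.ext <| Subtype.ext <| map_smul (GradedAlgebra.proj 𝒜 i) c (a : A)

/-- A subalgebra stable under the projections is graded. -/
abbrev inducedGradedAlgebra (𝒜 : ZMod 2 → Submodule k A) [GradedAlgebra 𝒜] (S : Subalgebra k A)
    (hS : ∀ i, ∀ a ∈ S, GradedAlgebra.proj 𝒜 i a ∈ S) : GradedAlgebra (inducedGrading 𝒜 S) where
  one_mem := one_mem_even 𝒜
  mul_mem _ _ _ _ ha hb := mul_mem_add 𝒜 ha hb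
  decompose' a := ∑ i, DirectSum.of (fun i => inducedGrading 𝒜 S i) i (inducedProj 𝒜 S hS i a)
  left_inv a := by
    rw [map_sum]
    simp only [DirectSum.coeAddMonoidHom_of]
    ext
    rw [AddSubmonoidClass.coe_finsetSum]
    exact (Fin.sum_univ_two fun i : ZMod 2 => GradedAlgebra.proj 𝒜 i (a : A)).trans
      (proj_add_proj 𝒜 a)
  right_inv x := by
    induction x using DirectSum.induction_on with
    | zero => simp only [map_zero, Finset.sum_const_zero]
    | of i x =>
      simp only [DirectSum.coeAddMonoidHom_of]
      rw [Finset.sum_eq_single i]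
      · congr 1
        exact Subtype.ext <| Subtype.ext <| proj_of_mem 𝒜 x.2
      · intro j _ hj
        have hz : inducedProj 𝒜 S hS j x = 0 :=
          Subtype.ext <| Subtype.ext <| proj_of_mem_ne 𝒜 x.2 hj.symm
        rw [hz, map_zero]
      · exact fun hi => absurd (Finset.mem_univ i) hi
    | add x y hx hy =>
      simp only [map_add, Finset.sum_add_distrib] at hx hy ⊢
      rw [hx, hy]

/-- Inclusions in each degree suffice: the even and odd pieces span the source, and their images
cannot overlap in the target. -/
lemma isEvenEquiv_of_le {𝒜 : ZMod 2 → Submodule k A} {ℬ : ZMod 2 → Submodule k B}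
    [GradedAlgebra ℬ] (e : A ≃ₐ[k] B) (hle : ∀ i, ∀ a ∈ 𝒜 i, e a ∈ ℬ i)
    (htop : ∀ a, ∃ a₀ ∈ 𝒜 0, ∃ a₁ ∈ 𝒜 1, a = a₀ + a₁) : IsEvenEquiv 𝒜 ℬ e := by
  intro i
  apply le_antisymm
  · rintro _ ⟨a, ha, rfl⟩
    exact hle i a ha
  · intro b hb
    obtain ⟨a₀, h₀, a₁, h₁, ha⟩ := htop (e.symm b)
    have hb' : b = e a₀ + e a₁ := by rw [← map_add, ← ha, e.apply_symm_apply]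
    have h₀' := hle 0 a₀ h₀
    have h₁' := hle 1 a₁ h₁
    fin_cases i
    · have : e a₁ = 0 := disjoint_even_odd ℬ (by
        rw [← sub_eq_of_eq_add' hb']; exact sub_mem hb h₀') h₁'
      exact ⟨a₀, h₀, by rw [hb', this, add_zero]; rfl⟩
    · have : e a₀ = 0 := disjoint_even_odd ℬ h₀' (by
        rw [← sub_eq_of_eq_add hb']; exact sub_mem hb h₁')
      exact ⟨a₁, h₁, by rw [hb', this, zero_add]; rfl⟩

lemma exists_tensorGrading_add (𝒜 : ZMod 2 → Submodule k A) (ℬ : ZMod 2 → Submodule k B)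
    [GradedAlgebra 𝒜] [GradedAlgebra ℬ] (t : 𝒜 ᵍ⊗[k] ℬ) :
    ∃ t₀ ∈ tensorGrading 𝒜 ℬ 0, ∃ t₁ ∈ tensorGrading 𝒜 ℬ 1, t = t₀ + t₁ := by
  suffices h : tensorGrading 𝒜 ℬ 0 ⊔ tensorGrading 𝒜 ℬ 1 = ⊤ by
    have ht : t ∈ tensorGrading 𝒜 ℬ 0 ⊔ tensorGrading 𝒜 ℬ 1 := by rw [h]; trivial
    obtain ⟨t₀, h₀, t₁, h₁, rfl⟩ := Submodule.mem_sup.1 ht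
    exact ⟨t₀, h₀, t₁, h₁, rfl⟩
  have hhom : ∀ i j, ∀ a ∈ 𝒜 i, ∀ b ∈ ℬ j, GradedTensorProduct.tmul k a b ∈
      tensorGrading 𝒜 ℬ 0 ⊔ tensorGrading 𝒜 ℬ 1 := by
    intro i j a ha b hb
    have hm : GradedTensorProduct.tmul k a b ∈ tensorGrading 𝒜 ℬ (i + j) :=
      Submodule.subset_span ⟨i, j, rfl, a, ha, b, hb, rfl⟩
    have hij : i + j = 0 ∨ i + j = 1 := by clear * -; revert i j; decide
    rcases hij with hij | hij <;> rw [hij] at hm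
    · exact Submodule.mem_sup_left hm
    · exact Submodule.mem_sup_right hm
  refine top_le_iff.1 fun t _ => ?_
  suffices h : ∀ u : A ⊗[k] B, GradedTensorProduct.of k 𝒜 ℬ u ∈
      tensorGrading 𝒜 ℬ 0 ⊔ tensorGrading 𝒜 ℬ 1 from h ((GradedTensorProduct.of k 𝒜 ℬ).symm t)
  intro u
  induction u with
  | zero => rw [map_zero]; exact zero_mem _
  | add x y hx hy => rw [map_add]; exact add_mem hx hy
  | tmul a b =>
    induction a using homogeneous_induction (𝒜 := 𝒜) with
    | hadd x y hx hy => rw [TensorProduct.add_tmul, map_add]; exact add_mem hx hy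
    | h i a ha =>
    induction b using homogeneous_induction (𝒜 := ℬ) with
    | hadd x y hx hy => rw [TensorProduct.tmul_add, map_add]; exact add_mem hx hy
    | h j b hb => exact hhom i j a ha b hb

/-- If `f` and `g` are even, `g` is purely even with central image, and multiplication is
bijective, then it is an isomorphism of superalgebras. -/
lemma exists_gradedTensor_equiv (𝒜 : ZMod 2 → Submodule k A) (ℬ : ZMod 2 → Submodule k B)
    (𝒞 : ZMod 2 → Submodule k C) [GradedAlgebra 𝒜] [GradedAlgebra ℬ] [GradedAlgebra 𝒞]
    [IsSuperCommutative 𝒞] (f : A →ₐ[k] C) (g : B →ₐ[k] C) (hf : ∀ i, ∀ a ∈ 𝒜 i, f a ∈ 𝒞 i)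
    (hg : ∀ i, ∀ b ∈ ℬ i, g b ∈ 𝒞 i) (hg0 : ∀ b, g b ∈ 𝒞 0)
    (hbij : Function.Bijective
      (LinearMap.mul' k C ∘ₗ TensorProduct.map f.toLinearMap g.toLinearMap)) :
    ∃ e : 𝒜 ᵍ⊗[k] ℬ ≃ₐ[k] C, IsEvenEquiv (tensorGrading 𝒜 ℬ) 𝒞 e ∧
      ∀ a b, e (GradedTensorProduct.tmul k a b) = f a * g b := by
  have hcomm : ∀ ⦃i j⦄ (a : 𝒜 i) (b : ℬ j), f a * g b = (-1 : ℤˣ) ^ (j * i) • (g b * f a) := by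
    intro i j a b
    have hj : j = 0 ∨ j = 1 := by clear * -; revert j; decide
    rcases hj with rfl | rfl
    · rw [zero_mul, uzpow_zero, one_smul, even_mul_comm 𝒞 (hg0 b)]
    -- The image of an odd `b` is both even and odd, hence zero, so the sign is harmless.
    · rw [disjoint_even_odd 𝒞 (hg0 b) (hg 1 b b.2), mul_zero, zero_mul, smul_zero]
  let l := GradedTensorProduct.lift 𝒜 ℬ f g hcomm
  have hl : ∀ a b, l (GradedTensorProduct.tmul k a b) = f a * g b :=
    GradedTensorProduct.lift_tmul 𝒜 ℬ f g hcomm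
  have hlb : Function.Bijective l := hbij
  refine ⟨AlgEquiv.ofBijective l hlb, isEvenEquiv_of_le _ ?_ (exists_tensorGrading_add 𝒜 ℬ), hl⟩
  intro i t ht
  unfold tensorGrading at ht
  induction ht using Submodule.span_induction with
  | zero => rw [map_zero]; exact zero_mem _
  | add x y _ _ hx hy => rw [map_add]; exact add_mem hx hy
  | smul c x _ hx => rw [map_smul]; exact Submodule.smul_mem _ c hx
  | mem x hx =>
    obtain ⟨p, q, rfl, a, ha, b, hb, rfl⟩ := hx
    rw [AlgEquiv.ofBijective_apply, hl]
    exact mul_mem_add 𝒞 (hf p a ha) (hg q b hb)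

end Gradings

/-! ### Compatibility with the gradings and assembly of the theorem -/

section Main

variable {k : Type*} [Field k] {A : Type*} [Ring A] [Algebra k A]
  {𝒜 : ZMod 2 → Submodule k A} [GradedAlgebra 𝒜] [Coalgebra k A] [IsSuperAffineHopfAlgebra 𝒜]
  {s : ℕ} {θ : Fin s → A} {D' : Fin s → A →ₗ[k] A}

lemma odd_pow_le (n : ℕ) : 𝒜 1 ^ n ≤ 𝒜 (n : ZMod 2) := by
  induction n with
  | zero => rw [pow_zero, Nat.cast_zero, Submodule.one_le]; exact one_mem_even 𝒜
  | succ n ih =>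
    rw [pow_succ, Nat.cast_succ, Submodule.mul_le]
    exact fun a ha b hb => mul_mem_add 𝒜 (ih ha) hb

namespace IsAdapted

lemma polyHom_graded (h : IsAdapted 𝒜 θ D') (hk : ringChar k ≠ 2) (i : ZMod 2)
    {x : SuperPoly k s} (hx : x ∈ superPolyGrading k s i) : h.polyHom hk x ∈ 𝒜 i := by
  have hle : superPolyGrading k s i ≤ (𝒜 i).comap (h.polyHom hk).toLinearMap := by
    refine iSup_le fun j => ?_
    obtain ⟨n, rfl⟩ := j
    rw [← Submodule.map_le_iff_le_comap, Submodule.map_pow]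
    refine le_trans ?_ (odd_pow_le n)
    refine pow_le_pow_left' ?_ n
    rintro _ ⟨_, ⟨v, rfl⟩, rfl⟩
    exact (h.polyHom_ι hk v).symm ▸ h.linearCombination_odd v
  exact hle hx

/-- The superpolynomial ring is isomorphic to the invariants. -/
def polyEquiv (h : IsAdapted 𝒜 θ D') (hk : ringChar k ≠ 2)
    (hn : ∀ n, 0 < n → n ≤ s → (n : k) ≠ 0) : SuperPoly k s ≃ₐ[k] invariantsSubalgebra 𝒜 :=
  AlgEquiv.ofBijective ((h.polyHom hk).codRestrict _ (h.polyHom_mem_invariants hk))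
    ⟨fun x y hxy => h.polyHom_injective hk hn (congrArg Subtype.val hxy), fun a => by
      obtain ⟨x, hx⟩ := h.range_polyHom hk hn a.2
      exact ⟨x, Subtype.ext hx⟩⟩

lemma bijective_polyHom_mul (h : IsAdapted 𝒜 θ D') (hk : ringChar k ≠ 2)
    (hn : ∀ n, 0 < n → n ≤ s → (n : k) ≠ 0) :
    Function.Bijective (LinearMap.mul' k A ∘ₗ
      TensorProduct.map (h.polyHom hk).toLinearMap h.kerEuler.val.toLinearMap) := by
  have h1 : LinearMap.mul' k A ∘ₗ
      TensorProduct.map (h.polyHom hk).toLinearMap h.kerEuler.val.toLinearMap =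
      (LinearMap.mul' k A ∘ₗ TensorProduct.map (invariantsSubalgebra 𝒜).val.toLinearMap
        h.kerEuler.val.toLinearMap) ∘ₗ
      (TensorProduct.congr (h.polyEquiv hk hn).toLinearEquiv
        (LinearEquiv.refl k h.kerEuler)).toLinearMap :=
    TensorProduct.ext' fun x b => rfl
  rw [h1, LinearMap.coe_comp]
  exact (h.bijective_mul hk hn).comp (LinearEquiv.bijective _)

lemma proj_mem_kerEuler (h : IsAdapted 𝒜 θ D') (hk : ringChar k ≠ 2)
    (hn : ∀ n, 0 < n → n ≤ s → (n : k) ≠ 0) (i : ZMod 2) {a : A} (ha : a ∈ h.kerEuler) :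
    GradedAlgebra.proj 𝒜 i a ∈ h.kerEuler := by
  have h0 := h.kerEuler_even hk hn ha
  by_cases hi : i = 0
  · subst hi
    rwa [proj_of_mem 𝒜 h0]
  · rw [proj_of_mem_ne 𝒜 h0 (Ne.symm hi)]
    exact zero_mem _

end IsAdapted

lemma natCast_ne_zero_of_ringChar (hchar : ringChar k = 0 ∨ s < ringChar k) (n : ℕ) (hpos : 0 < n)
    (hns : n ≤ s) : (n : k) ≠ 0 := by
  rw [Ne, ringChar.spec]
  intro hd
  rcases hchar with h0 | hlt
  · rw [h0, zero_dvd_iff] at hd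
    omega
  · exact absurd (Nat.le_of_dvd hpos hd) (by omega)

end Main

end SuperHopf

end

open SuperHopf
theorem mainTheorem7 {k A : Type*} [Field k] (hk : ringChar k ≠ 2) [Ring A] [Algebra k A]
    (𝒜 : ZMod 2 → Submodule k A) [GradedAlgebra 𝒜] [Coalgebra k A]
    [IsSuperAffineHopfAlgebra 𝒜] (s : ℕ) (hs : s = Module.finrank k (gMinus 𝒜))
    (hchar : ringChar k = 0 ∨ s < ringChar k) :
    Module.Finite k (gMinus 𝒜) ∧
    (∃ (θ : Fin s → A) (D' : Fin s → A →ₗ[k] A), IsAdapted 𝒜 θ D') ∧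
    ∀ (θ : Fin s → A) (D' : Fin s → A →ₗ[k] A), IsAdapted 𝒜 θ D' →
      ∃ AG Btilde : Subalgebra k A,
        Subalgebra.toSubmodule AG = invariants 𝒜 ∧
        Subalgebra.toSubmodule Btilde = LinearMap.ker (eulerDerivation θ D') ∧
        -- `π : B̃ → B` is an isomorphism of algebras, and it is even
        Function.Bijective ((piMap 𝒜).comp Btilde.val) ∧
        Subalgebra.toSubmodule Btilde ≤ 𝒜 0 ∧
        -- `A^G` and `B̃` are graded subalgebras
        ∃ (_ : GradedAlgebra (inducedGrading 𝒜 AG)) (_ : GradedAlgebra (inducedGrading 𝒜 Btilde)),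
          -- `A = A^G ⊗^ε B̃` through multiplication
          (∃ e : (inducedGrading 𝒜 AG) ᵍ⊗[k] (inducedGrading 𝒜 Btilde) ≃ₐ[k] A,
            IsEvenEquiv (tensorGrading (inducedGrading 𝒜 AG) (inducedGrading 𝒜 Btilde)) 𝒜 e ∧
            ∀ (x : AG) (b : Btilde), e (GradedTensorProduct.tmul k x b) = (x : A) * (b : A)) ∧
          -- `k[θ₁, …, θₛ] ≅ A^G` and `k[θ₁, …, θₛ] ⊗^ε B̃ ≅ A`
          ∃ f : SuperPoly k s ≃ₐ[k] AG,
            IsEvenEquiv (superPolyGrading k s) (inducedGrading 𝒜 AG) f ∧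
            (∀ i, (f (superPolyVar k i) : A) = θ i) ∧
            ∃ e : (superPolyGrading k s) ᵍ⊗[k] (inducedGrading 𝒜 Btilde) ≃ₐ[k] A,
              IsEvenEquiv (tensorGrading (superPolyGrading k s) (inducedGrading 𝒜 Btilde)) 𝒜 e ∧
              ∀ (p : SuperPoly k s) (b : Btilde),
                e (GradedTensorProduct.tmul k p b) = (f p : A) * (b : A) := by
  have hn := natCast_ne_zero_of_ringChar hchar
  refine ⟨Module.Finite.equiv (gMinusEquiv 𝒜).symm, exists_isAdapted 𝒜 hk hs, fun θ D' h => ?_⟩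
  let gAG := inducedGradedAlgebra 𝒜 (invariantsSubalgebra 𝒜) fun i _ ha =>
    proj_mem_invariants 𝒜 i ha
  let gB := inducedGradedAlgebra 𝒜 h.kerEuler fun i _ ha => h.proj_mem_kerEuler hk hn i ha
  refine ⟨invariantsSubalgebra 𝒜, h.kerEuler, rfl, rfl, h.bijective_kerEuler hk hn,
    fun a ha => h.kerEuler_even hk hn ha, gAG, gB, ?_, h.polyEquiv hk hn, ?_, ?_, ?_⟩
  · exact exists_gradedTensor_equiv (inducedGrading 𝒜 (invariantsSubalgebra 𝒜))
      (inducedGrading 𝒜 h.kerEuler) 𝒜 (invariantsSubalgebra 𝒜).val h.kerEuler.val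
      (fun _ _ ha => ha) (fun _ _ hb => hb) (fun b => h.kerEuler_even hk hn b.2)
      (h.bijective_mul hk hn)
  · exact isEvenEquiv_of_le _ (fun i x hx => h.polyHom_graded hk i hx) fun x =>
      ⟨_, proj_mem (superPolyGrading k s) 0 x, _, proj_mem (superPolyGrading k s) 1 x,
        (proj_add_proj (superPolyGrading k s) x).symm⟩
  · exact h.polyHom_var hk
  · exact exists_gradedTensor_equiv (superPolyGrading k s)
      (inducedGrading 𝒜 h.kerEuler) 𝒜 (h.polyHom hk) h.kerEuler.val
      (fun i _ ha => h.polyHom_graded hk i ha) (fun _ _ hb => hb)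
      (fun b => h.kerEuler_even hk hn b.2) (h.bijective_polyHom_mul hk hn)
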